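/- **Setting.** For $\tau\in\mathbb H$ put $E^\vee_\tau=\mathbb C/(\mathbb Z+\mathbb Z\tau)$; these curves form the universal dual elliptic curve $\widetilde{\mathcal E}^\vee\to\mathbb H$. Let $U\subset\mathbb H$ be a holomorphic submanifold, and let $E^\vee\to U$ be the restriction of $\widetilde{\mathcal E}^\vee$ and $(E^\vee)^{\times 3}$ its triple fibre product over $U$ (the space of $U(1)^3$-bundles on the dual family $E$). Let $\mathcal O(-0)$ be the ideal sheaf of the zero section of $E^\vee$. For a line bundle $\mathcal L$ on $E^\vee$ let $\Theta^3(\mathcal L)$ be the line bundle on $(E^\vee)^{\times3}$ with fibre $$\mathcal L_{x+y+z}\otimes\mathcal L_x\otimes\mathcal L_y\otimes\mathcal L_z\otimes\mathcal L_{x+y}^\vee\otimes\mathcal L_{x+z}^\vee\otimes\mathcal L_{y+z}^\vee\otimes\mathcal L_0^\vee$$ at $(x,y,z)$. A $\Theta^3(\mathcal O(-0))$-twisted $U(1)^3$-equivariant elliptic cohomology class (of degree $0$) is a holomorphic section of $\Theta^3(\mathcal O(-0))$ on $(E^\vee)^{\times 3}$. Its completion in $\mathrm{Ell}^0(BU(1)^3)=\mathcal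 O(U)[\![x,y,z]\!]$ is its Taylor expansion along the zero section, where $\mathcal O(-0)$ is trivialized near the zero section by the coordinate $w$ of $\mathbb C$. Here $\mathcal O(U)$ is the ring of holomorphic functions on $U$ that are meromorphic at infinity: along every unit speed geodesic ray $c$ in $U$, $|f(c(t))|\le\exp(C e^{t})$ for some $C$ and all $t\ge 0$. With $q=e^{2\pi i\tau}$ and $y=e^{2\pi i w}$ let $$\sigma(\tau,w)=(y^{1/2}-y^{-1/2})\prod_{n>0}\frac{(1-q^ny)(1-q^ny^{-1})}{(1-q^n)^2},\qquad \upsilon(\tau,w)=-y^{1/2}\sigma(\tau,w).$$ The Ando–Hopkins–Strickland class $s\in\mathcal O(U)[\![x,y,z]\!]$ of the canonical $MO\langle 8\rangle$-orientation is $$s=\frac{\sigma(\tau,x+y+z)\,\sigma(\tau,x)\,\sigma(\tau,y)\,\sigma(\tau,z)}{\sigma(\tau,x+y)\,\sigma(\tau,x+z)\,\sigma(\tau,y+z)\,\sigma(\tau,0)},$$ regarded as a section of $\Theta^3(\mathcal O(-0))$ near the zero section in the above trivialization: each $\sigma(\tau,w)$ is read as the power series $\sigma(\tau,w)/w$, with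 value $\partial_w\sigma(\tau,0)$ at $w=0$. An equivariant refinement of the $MO\langle 8\rangle$-orientation is a class as above whose completion is $s$. The function $\upsilon$ defines a nowhere vanishing section $\tilde c$ of $\mathcal O(-0)\otimes\mathcal A$, where $\mathcal A$ is the line bundle on $E^\vee$ with descent datum from $U\times\mathbb C$ given by the transformation law of $\upsilon$ under $\mathbb Z+\mathbb Z\tau$. The twisted equivariant Euler class of a virtual representation $V=\sum_\chi n_\chi\chi$ of $U(1)^3$ of virtual dimension $0$ is $\prod_\chi(\chi^*\tilde c)^{n_\chi}$. Let $L_1,L_2,L_3$ be the defining representations of the factors of $U(1)^3$, and $V_3=(L_1-1)\otimes(L_2-1)\otimes(L_3-1)$; for $V=V_3$ the descent data of the twists by $\mathcal A$ cancel, so that the Euler class of $V_3$ is a section of $\Theta^3(\mathcal O(-0))$. **Theorem.** 1. For every $U$ as above, $s$ is a class in $\mathcal O(U)[\![x,y,z]\!]$, and there is a unique equivariant refinement $s_{U(1)}$ of the $MO\langle 8\rangle$-orientation for the family over $U$. 2. $s_{U(1)}$ equals the twisted equivariant Euler class of $V_3$. 3. In the universal case $U=\mathbb H$, $s_{U(1)}$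 descends to the stack $\mathsf{Bun}_{U(1)^3}(\mathcal E)\simeq[(\widetilde{\mathcal E}^\vee\times_{\mathbb H}\widetilde{\mathcal E}^\vee\times_{\mathbb H}\widetilde{\mathcal E}^\vee)/\mathrm{SL}_2(\mathbb Z)]$: it is invariant under the action of $\mathrm{SL}_2(\mathbb Z)$ on $\Theta^3(\mathcal O(-0))$ that covers $(\tau,x,y,z)\mapsto\bigl(\tfrac{a\tau+b}{c\tau+d},\tfrac{x}{c\tau+d},\tfrac{y}{c\tau+d},\tfrac{z}{c\tau+d}\bigr)$. -/

import Mathlib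

open Filter Topology
open scoped UpperHalfPlane

noncomputable section

namespace EllCube

/-! ### The family of (dual) elliptic curves -/

/-- A holomorphic submanifold of `ℍ`: near each of its points it is open (dimension one)
or reduced to that point (dimension zero). -/
def IsHolSubmanifold (U : Set ℍ) : Prop :=
  ∀ τ ∈ U, U ∈ 𝓝 τ ∨ ∃ V ∈ 𝓝 τ, V ∩ U = {τ}

/-- The period lattice `ℤ + ℤτ`. -/
def lattice (τ : ℍ) : AddSubgroup ℂ := AddSubgroup.closure {1, (τ : ℂ)}

/-- The fibre `ℂ / (ℤ + ℤτ)` over `τ` of the universal dual elliptic curve. -/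
abbrev DualCurve (τ : ℍ) : Type := ℂ ⧸ lattice τ

/-- The point `(τ, [x₀], [x₁], [x₂])` of the triple fibre product of the dual curve, which is
the moduli space of `U(1)³`-bundles on the elliptic curve over `τ`. -/
def proj (τ : ℍ) (x : Fin 3 → ℂ) : Fin 3 → DualCurve τ :=
  fun i => QuotientAddGroup.mk (x i)

/-- Holomorphy, at a point, of a function of `τ ∈ ℍ` and of a vector `x`. -/
def HolAt {E : Type*} [NormedAddCommGroup E] [NormedSpace ℂ E]
    (f : ℍ → E → ℂ) (τ : ℍ) (x : E) : Prop :=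
  AnalyticAt ℂ (fun q : ℂ × E => f (UpperHalfPlane.ofComplex q.1) q.2) ((τ : ℂ), x)

/-! ### The line bundle `Θ³(O(-0))` -/

/-- The value `ℓ_{x+y+z} ℓ_x ℓ_y ℓ_z / (ℓ_{x+y} ℓ_{x+z} ℓ_{y+z} ℓ_0)`; here `ℓ I` stands for
the factor belonging to the partial sum over `I ⊆ {0, 1, 2}`. -/
def cube {K : Type*} [Mul K] [Inv K] (l : Finset (Fin 3) → K) : K :=
  (l {0, 1, 2} * l {0} * l {1} * l {2}) * (l {0, 1} * l {0, 2} * l {1, 2} * l ∅)⁻¹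

/-- The partial sum of the coordinates over `I ⊆ {0, 1, 2}`. -/
def psum (I : Finset (Fin 3)) (x : Fin 3 → ℂ) : ℂ := ∑ i ∈ I, x i

/-- The line bundle `O(-0)` on the dual curve is the ideal sheaf of the zero section. We work
on the cover with coordinate `w`, where the zero section becomes the lattice points. The fibre
of an ideal sheaf `J` at a point `p` is `J_p / m_p J_p`. Off the lattice it is `ℂ`, via the value
at `p`; at a lattice point it is the conormal line along the fibre, identified with `ℂ` by `dw`,
and the class of `g` is the derivative `∂g/∂w (p)`. In either case the complex number below is
the element of the fibre of `O(-0)` at `w` defined by a function `g` that vanishes on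
the lattice. -/
def fibreValue (τ : ℍ) (g : ℂ → ℂ) (w : ℂ) : ℂ :=
  open Classical in if w ∈ lattice τ then deriv g w else g w

/-- `g` is a local generator of `O(-0)` near `(τ₀, w₀)`: it is holomorphic there, it vanishes on
the (preimage of the) zero section, and its class in the fibre at `(τ₀, w₀)` is nonzero. -/
def IsLocalGenerator (g : ℍ → ℂ → ℂ) (τ₀ : ℍ) (w₀ : ℂ) : Prop :=
  HolAt g τ₀ w₀ ∧
  (∀ᶠ p : ℍ × ℂ in 𝓝 (τ₀, w₀), p.2 ∈ lattice p.1 → g p.1 p.2 = 0) ∧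
  fibreValue τ₀ (g τ₀) w₀ ≠ 0

/-- A global section of `Θ³(O(-0))` on the triple fibre product of the dual curve over `U`, that
is, a `Θ³(O(-0))`-twisted `U(1)³`-equivariant elliptic cohomology class (of degree zero). The
fibre of `Θ³(L)` at `(x, y, z)` is
`L_{x+y+z} ⊗ L_x ⊗ L_y ⊗ L_z ⊗ (L_{x+y} ⊗ L_{x+z} ⊗ L_{y+z} ⊗ L_0)^∨`. By the identification
of the fibres of `L = O(-0)` with `ℂ` in `fibreValue`, it is `ℂ`, and local generators
`g I` of `L` near the eight partial sums give the local frame `cube (fun I => [g I])`. A section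
is holomorphic when its coefficient with respect to such local frames is holomorphic. -/
structure TwistedClass (U : Set ℍ) where
  /-- the section -/
  toFun : (τ : U) → (Fin 3 → DualCurve τ.1) → ℂ
  /-- it is holomorphic -/
  hol : ∀ (τ₀ : U) (x₀ : Fin 3 → ℂ),
    ∃ (g : Finset (Fin 3) → ℍ → ℂ → ℂ) (F : ℍ → (Fin 3 → ℂ) → ℂ),
      (∀ I, IsLocalGenerator (g I) τ₀.1 (psum I x₀)) ∧ HolAt F τ₀.1 x₀ ∧
      ∀ᶠ p : ℍ × (Fin 3 → ℂ) in 𝓝 (τ₀.1, x₀), ∀ h : p.1 ∈ U,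
        toFun ⟨p.1, h⟩ (proj p.1 p.2) =
          F p.1 p.2 * cube (fun I => fibreValue p.1 (g I p.1) (psum I p.2))

/-! ### Non-equivariant elliptic cohomology of `BU(1)³` -/

/-- Unit speed parametrized geodesic rays of the hyperbolic plane. -/
def IsGeodesicRay (c : ℝ → ℍ) : Prop :=
  ∀ s t : ℝ, 0 ≤ s → 0 ≤ t → dist (c s) (c t) = |s - t|

/-- The ring `O(U)`: holomorphic functions on `U` that are meromorphic at infinity, i.e. have at
most polynomial growth along geodesics in `U` that escape to the boundary. With `t` the arc
length this is measured in powers of `exp (exp t)`, so that along a vertical geodesic it means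
growth as a power of `|q|⁻¹ = exp (2π Im τ)`, as it does for weakly holomorphic
modular forms. -/
def holRing (U : Set ℍ) : Subalgebra ℂ (U → ℂ) where
  carrier := {f |
    (∀ τ₀ : U, ∃ F : ℍ → ℂ,
      AnalyticAt ℂ (fun w : ℂ => F (UpperHalfPlane.ofComplex w)) (τ₀.1 : ℂ) ∧
      ∀ᶠ τ in 𝓝 τ₀.1, ∀ h : τ ∈ U, f ⟨τ, h⟩ = F τ) ∧
    (∀ c : ℝ → ℍ, IsGeodesicRay c → ∀ hc : ∀ t, 0 ≤ t → c t ∈ U,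
      ∃ C : ℝ, ∀ (t : ℝ) (ht : 0 ≤ t), ‖f ⟨c t, hc t ht⟩‖ ≤ Real.exp (C * Real.exp t))}
  mul_mem' := by
    rintro f g ⟨hf, hf'⟩ ⟨hg, hg'⟩
    refine ⟨fun τ₀ => ?_, fun c hc hcU => ?_⟩
    · obtain ⟨F, hF, hF'⟩ := hf τ₀
      obtain ⟨G, hG, hG'⟩ := hg τ₀
      refine ⟨fun τ => F τ * G τ, hF.mul hG, ?_⟩
      filter_upwards [hF', hG'] with τ h1 h2 h
      simp [h1 h, h2 h]
    · obtain ⟨C, hC⟩ := hf' c hc hcU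
      obtain ⟨D, hD⟩ := hg' c hc hcU
      refine ⟨C + D, fun t ht => ?_⟩
      rw [Pi.mul_apply, norm_mul, add_mul, Real.exp_add]
      exact mul_le_mul (hC t ht) (hD t ht) (norm_nonneg _) (Real.exp_nonneg _)
  add_mem' := by
    rintro f g ⟨hf, hf'⟩ ⟨hg, hg'⟩
    refine ⟨fun τ₀ => ?_, fun c hc hcU => ?_⟩
    · obtain ⟨F, hF, hF'⟩ := hf τ₀
      obtain ⟨G, hG, hG'⟩ := hg τ₀
      refine ⟨fun τ => F τ + G τ, hF.add hG, ?_⟩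
      filter_upwards [hF', hG'] with τ h1 h2 h
      simp [h1 h, h2 h]
    · obtain ⟨C, hC⟩ := hf' c hc hcU
      obtain ⟨D, hD⟩ := hg' c hc hcU
      refine ⟨max C D + 1, fun t ht => ?_⟩
      have e1 : (1 : ℝ) ≤ Real.exp t := Real.one_le_exp ht
      have e2 : (2 : ℝ) ≤ Real.exp (Real.exp t) := by
        have := Real.add_one_le_exp (Real.exp t)
        linarith
      have hx : ∀ B : ℝ, B ≤ max C D →
          Real.exp (B * Real.exp t) ≤ Real.exp (max C D * Real.exp t) := fun B hB =>
        Real.exp_le_exp.mpr (mul_le_mul_of_nonneg_right hB (Real.exp_nonneg t))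
      have h1 := (hC t ht).trans (hx C (le_max_left _ _))
      have h2 := (hD t ht).trans (hx D (le_max_right _ _))
      have h3 := norm_add_le (f ⟨c t, hcU t ht⟩) (g ⟨c t, hcU t ht⟩)
      rw [Pi.add_apply, add_mul, one_mul, Real.exp_add]
      have h4 := mul_le_mul_of_nonneg_left e2 (Real.exp_nonneg (max C D * Real.exp t))
      linarith
  algebraMap_mem' := by
    intro r
    refine ⟨fun τ₀ => ⟨fun _ => r, analyticAt_const, ?_⟩, fun c hc hcU => ⟨‖r‖, fun t ht => ?_⟩⟩
    · exact Eventually.of_forall fun τ h => rfl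
    · have e1 : (1 : ℝ) ≤ Real.exp t := Real.one_le_exp ht
      have h1 : ‖r‖ ≤ ‖r‖ * Real.exp t := le_mul_of_one_le_right (norm_nonneg r) e1
      have h2 := Real.add_one_le_exp (‖r‖ * Real.exp t)
      change ‖r‖ ≤ _
      linarith

/-- `Ell⁰(BU(1) × BU(1) × BU(1)) = O(U)[[x, y, z]]`. -/
abbrev EllBorel (U : Set ℍ) : Type := MvPowerSeries (Fin 3) (holRing U)

/-- Specialization of a class in `Ell⁰(BU(1)³)` to the curve over `τ ∈ U`. -/
def EllBorel.at {U : Set ℍ} (a : EllBorel U) (τ : U) : MvPowerSeries (Fin 3) ℂ :=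
  MvPowerSeries.map ((Pi.evalRingHom (fun _ : U => ℂ) τ).comp (holRing U).val.toRingHom) a

/-- `a` is the Taylor expansion at `0` of the function `F`, as a convergent power series. -/
def IsTaylorExpansion (F : (Fin 3 → ℂ) → ℂ) (a : MvPowerSeries (Fin 3) ℂ) : Prop :=
  ∀ᶠ x in 𝓝 (0 : Fin 3 → ℂ),
    HasSum (fun n : Fin 3 →₀ ℕ => MvPowerSeries.coeff n a * n.prod fun i k => x i ^ k) (F x)

/-- The completion map from sections of `Θ³(O(-0))` to `Ell⁰(BU(1)³)` sends `s` to `a`. Near the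
zero section `O(-0)` is trivialized by the standard coordinate `w`, a generator there, and
`Θ³(O(-0))` by the resulting frame; the image of `s` is the Taylor expansion, along the
zero section, of the coefficient of `s` in that frame. -/
def TwistedClass.HasCompletion {U : Set ℍ} (s : TwistedClass U) (a : EllBorel U) : Prop :=
  ∀ τ : U, IsTaylorExpansion
    (fun x => s.toFun τ (proj τ.1 x) *
      (cube (fun I => fibreValue τ.1 (fun w => w) (psum I x)))⁻¹) (a.at τ)

/-! ### The sigma function and the Ando--Hopkins--Strickland class -/

/-- The Weierstrass sigma function
`(y^{1/2} - y^{-1/2}) ∏_{n>0} (1 - qⁿ y)(1 - qⁿ y⁻¹) / (1 - qⁿ)²`,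
with `q = exp (2πiτ)` and `y = exp (2πiz)`. -/
def sigma (τ : ℍ) (z : ℂ) : ℂ :=
  (Complex.exp (Real.pi * Complex.I * z) - Complex.exp (-(Real.pi * Complex.I * z))) *
    ∏' n : ℕ,
      ((1 - Complex.exp (2 * Real.pi * Complex.I * τ) ^ (n + 1) *
            Complex.exp (2 * Real.pi * Complex.I * z)) *
        (1 - Complex.exp (2 * Real.pi * Complex.I * τ) ^ (n + 1) *
            Complex.exp (-(2 * Real.pi * Complex.I * z))) /
        (1 - Complex.exp (2 * Real.pi * Complex.I * τ) ^ (n + 1)) ^ 2)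

/-- The function `υ(τ, z) = -y^{1/2} σ(τ, z)`, the normalized character of the vacuum
representation of the loop group of `U(1)`. -/
def upsilon (τ : ℍ) (z : ℂ) : ℂ := -Complex.exp (Real.pi * Complex.I * z) * sigma τ z

/-- The Taylor series at `0` of `σ(τ, w) / w`, that is, of `σ` as a section of `O(-0)` in the
trivialization by the coordinate `w`. -/
def sigmaSeries (τ : ℍ) : PowerSeries ℂ :=
  PowerSeries.mk fun n => iteratedDeriv (n + 1) (sigma τ) 0 / ((n + 1).factorial : ℂ)

/-- The cubical class at `τ`,
`σ(x+y+z) σ(x) σ(y) σ(z) / (σ(x+y) σ(x+z) σ(y+z) σ(0))`, as a formal power series in `x, y, z`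
in the trivialization of `O(-0)` by the coordinate: each `σ(w)` is replaced by the power
series `σ(w) / w`, with the invertible value `σ'(0)` at `w = 0`. -/
def cubicalSeries (τ : ℍ) : MvPowerSeries (Fin 3) ℂ :=
  cube fun I => (sigmaSeries τ).subst (∑ i ∈ I, (MvPowerSeries.X i : MvPowerSeries (Fin 3) ℂ))

/-- `a` is the cubical class, as an element of `Ell⁰(BU(1)³) = O(U)[[x, y, z]]`. -/
def IsCubicalClass {U : Set ℍ} (a : EllBorel U) : Prop :=
  ∀ τ : U, a.at τ = cubicalSeries τ.1

/-- `s` is an equivariant refinement of the cubical class: the cubical class exists in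
`O(U)[[x, y, z]]` and is the image of `s` under the completion map. -/
def TwistedClass.IsRefinement {U : Set ℍ} (s : TwistedClass U) : Prop :=
  ∃ a : EllBorel U, IsCubicalClass a ∧ s.HasCompletion a

/-! ### The twisted equivariant Euler class -/

/-- The representation ring of `U(1)³`: the integral group ring of its character group `ℤ³`. -/
abbrev RepRing : Type := AddMonoidAlgebra ℤ (Fin 3 → ℤ)

/-- The defining representation `Lᵢ` of the `i`-th factor of `U(1)³`. -/
def L (i : Fin 3) : RepRing := AddMonoidAlgebra.single (Pi.single i 1) 1

/-- The virtual representation `V₃ = (L₁ - 1)(L₂ - 1)(L₃ - 1)`. -/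
def V₃ : RepRing := (L 0 - 1) * (L 1 - 1) * (L 2 - 1)

/-- The twisted equivariant Euler class of a virtual representation `V = ∑ n_χ χ`. The Euler
class of the defining representation of `U(1)` is the nowhere vanishing section
of `O(-0) ⊗ A` given by `υ`, where `A` is the line bundle on the dual curve whose
descent datum from the cover is the transformation law of `υ`. The Euler class of `V` is the
product of the `n_χ`-th powers of its pullbacks along the characters `χ`, on the cover. (The
powers of the Bott class are left out: they cancel when `V` has virtual dimension zero.) -/
def eulerClass (V : RepRing) (τ : ℍ) (x : Fin 3 → ℂ) : ℂ :=
  V.coeff.prod fun χ n => fibreValue τ (upsilon τ) (∑ i, (χ i : ℂ) * x i) ^ n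

/-! ### Descent to the stack of `U(1)³`-bundles -/

/-- The pullback map of fibres of `O(-0)` along `(τ, w) ↦ (γτ, w / (cτ + d))`: it is the identity
on values of functions, and multiplication by `(cτ + d)⁻¹` on their derivatives at lattice
points. -/
def pullbackFactor (γ : Matrix.SpecialLinearGroup (Fin 2) ℤ) (τ : ℍ) (w : ℂ) : ℂ :=
  open Classical in
    if w ∈ lattice τ then (((γ 1 0 : ℤ) : ℂ) * (τ : ℂ) + ((γ 1 1 : ℤ) : ℂ))⁻¹ else 1

/-- A section over the universal family descends to the stack, the quotient by `SL₂(ℤ)`, iff it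
is invariant: its pullback along each `(τ, [x]) ↦ (γτ, [x / (cτ + d)])` is itself. -/
def TwistedClass.Descends (s : TwistedClass Set.univ) : Prop :=
  ∀ (γ : Matrix.SpecialLinearGroup (Fin 2) ℤ) (τ : ℍ) (x : Fin 3 → ℂ),
    cube (fun I => pullbackFactor γ τ (psum I x)) *
        s.toFun ⟨γ • τ, Set.mem_univ _⟩
          (proj (γ • τ)
            (fun i => x i / (((γ 1 0 : ℤ) : ℂ) * (τ : ℂ) + ((γ 1 1 : ℤ) : ℂ)))) =
      s.toFun ⟨τ, Set.mem_univ _⟩ (proj τ x)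

end EllCube

end

/-! For fixed τ the function σ is entire in w, has simple zeros exactly on the lattice, and is
multiplied by the exponential of an affine function of w under a lattice translation. So it
generates O(-0) at every point of the cover. Its cube `cubeSigma` is invariant under translations:
the exponents are polynomials of degree at most two in quantities additive in I, and the alternating
sum over subsets I of three coordinates kills such polynomials. Thus `sigmaClass` is a nowhere
vanishing section of Θ³(O(-0)). Since υ and σ differ by the exponential of an affine function, they
have the same cube, and expanding V₃ over subsets identifies it with the Euler class.

Uniqueness is the identity theorem on each fibre: a section divided by `cubeSigma` is entire on ℂ³,
hence determined by its germ at 0 (`TwistedClass.eq_of_hasCompletion`).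

Modular invariance needs no explicit transformation formula. The ratio of the pullback of σ(γτ, ·)
to σ(τ, ·) is entire without zeros, with exponential-affine automorphy factors. Its second
logarithmic derivative is elliptic and entire, hence constant, so the ratio is the exponential of a
quadratic polynomial (`exists_eq_exp_quadratic`), which the cube kills.

That s has coefficients in O(U) rests on joint holomorphy of σ in (τ, w), on Cauchy estimates
combined with bounds for the infinite product (`exists_norm_coeff_sigmaSeries_le`), and on the
leading coefficient 2πi of σ being a unit independent of τ. That s is the completion of `sigmaClass`
is an absolute convergence argument for substituted power series. -/

noncomputable section

namespace EllCube

/-! ### Osgood's lemma in two variables -/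

section Osgood

open Metric

/-- The Cauchy integral over a circle, as a functional on continuous functions on it. -/
def sphereIntegral (b : ℂ) {R : ℝ} (hR : 0 ≤ R) : C(sphere b R, ℂ) →L[ℂ] ℂ :=
  LinearMap.mkContinuous
    { toFun := fun φ => ∫ θ in (0 : ℝ)..2 * Real.pi,
        deriv (circleMap b R) θ * φ ⟨circleMap b R θ, circleMap_mem_sphere b hR θ⟩
      map_add' := fun φ ψ => by
        simp only [ContinuousMap.add_apply, mul_add]
        apply intervalIntegral.integral_add <;>
        · apply Continuous.intervalIntegrable
          simp only [deriv_circleMap]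
          fun_prop
      map_smul' := fun c φ => by
        simp only [ContinuousMap.smul_apply, smul_eq_mul, RingHom.id_apply]
        rw [← intervalIntegral.integral_const_mul]
        congr 1 with θ
        ring }
    (R * |2 * Real.pi - 0|) fun φ => by
      have := intervalIntegral.norm_integral_le_of_norm_le_const (a := 0) (b := 2 * Real.pi)
        (C := R * ‖φ‖) (f := fun θ => deriv (circleMap b R) θ *
          φ ⟨circleMap b R θ, circleMap_mem_sphere b hR θ⟩) fun θ _ => by
            rw [norm_mul]
            have h1 : ‖deriv (circleMap b R) θ‖ = R := by simp [abs_of_nonneg hR]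
            rw [h1]
            exact mul_le_mul_of_nonneg_left (φ.norm_coe_le_norm _) hR
      refine this.trans (le_of_eq ?_)
      ring

theorem sphereIntegral_apply {b : ℂ} {R : ℝ} (hR : 0 ≤ R) (φ : C(sphere b R, ℂ)) (f : ℂ → ℂ)
    (h : ∀ s : sphere b R, φ s = f s) : sphereIntegral b hR φ = ∮ z in C(b, R), f z := by
  simp [sphereIntegral, circleIntegral, h]

/-- Inversion is analytic at units of a Banach algebra, and s - w₀ is a unit of C(sphere) because w₀
lies strictly inside the circle. -/
theorem analyticAt_cauchyKernel (b : ℂ) {R : ℝ} {w₀ : ℂ} (hw : w₀ ∈ ball b R) :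
    AnalyticAt ℂ (fun w => Ring.inverse
      ((⟨Subtype.val, continuous_subtype_val⟩ : C(sphere b R, ℂ)) -
        algebraMap ℂ C(sphere b R, ℂ) w)) w₀ := by
  have hu : IsUnit ((⟨Subtype.val, continuous_subtype_val⟩ : C(sphere b R, ℂ)) -
        algebraMap ℂ C(sphere b R, ℂ) w₀) := by
    rw [ContinuousMap.isUnit_iff_forall_ne_zero]
    rintro ⟨s, hs⟩ h
    have : s = w₀ := by simpa [sub_eq_zero, Algebra.algebraMap_eq_smul_one] using h
    subst this
    rw [mem_sphere] at hs
    rw [mem_ball] at hw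
    exact hw.ne hs
  have h1 := analyticAt_inverse (𝕜 := ℂ) hu.unit
  have h2 : AnalyticAt ℂ (fun w => (⟨Subtype.val, continuous_subtype_val⟩ : C(sphere b R, ℂ)) -
        algebraMap ℂ C(sphere b R, ℂ) w) w₀ :=
    analyticAt_const.sub ((Algebra.linearMap ℂ C(sphere b R, ℂ)).toContinuousLinearMap.analyticAt w₀)
  exact AnalyticAt.fun_comp (by simpa using! h1) h2

theorem cauchyKernel_apply {b : ℂ} {R : ℝ} {w : ℂ} (hw : w ∈ ball b R) (s : sphere b R) :
    Ring.inverse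
      ((⟨Subtype.val, continuous_subtype_val⟩ : C(sphere b R, ℂ)) -
        algebraMap ℂ C(sphere b R, ℂ) w) s = ((s : ℂ) - w)⁻¹ := by
  have hne : ∀ s : sphere b R, (s : ℂ) - w ≠ 0 := by
    rintro ⟨s, hs⟩ h
    have : s = w := by simpa [sub_eq_zero] using h
    subst this
    rw [mem_sphere] at hs
    rw [mem_ball] at hw
    exact hw.ne hs
  have hu : IsUnit ((⟨Subtype.val, continuous_subtype_val⟩ : C(sphere b R, ℂ)) -
        algebraMap ℂ C(sphere b R, ℂ) w) := by
    rw [ContinuousMap.isUnit_iff_forall_ne_zero]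
    intro s
    simpa [Algebra.algebraMap_eq_smul_one] using hne s
  have h := congrArg (fun φ : C(sphere b R, ℂ) => φ s) (Ring.inverse_mul_cancel _ hu)
  simp only [ContinuousMap.mul_apply, ContinuousMap.one_apply] at h
  refine eq_inv_of_mul_eq_one_left ?_
  simpa [Algebra.algebraMap_eq_smul_one] using h

/-- A continuous function on a closed bidisc that is holomorphic in each variable is analytic
at the centre. -/
theorem analyticAt_of_separately {f : ℂ × ℂ → ℂ} {a b : ℂ} {R : ℝ} (hR : 0 < R)
    (hc : ContinuousOn f (closedBall a R ×ˢ closedBall b R))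
    (h1 : ∀ w ∈ closedBall b R, DifferentiableOn ℂ (fun z => f (z, w)) (closedBall a R))
    (h2 : ∀ z ∈ closedBall a R, DifferentiableOn ℂ (fun w => f (z, w)) (closedBall b R)) :
    AnalyticAt ℂ f (a, b) := by
  classical
  let Ψ : C(closedBall a R × sphere b R, ℂ) :=
    ⟨fun p => f (p.1.1, p.2.1), hc.comp_continuous (by fun_prop) fun p =>
      ⟨p.1.2, sphere_subset_closedBall p.2.2⟩⟩
  -- Currying makes f a Banach-valued function of one variable, so the vector-valued Cauchy integral
  -- `G` below is analytic in z, uniformly over the circle in w.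
  let Φ : ℂ → C(sphere b R, ℂ) := fun z => if h : z ∈ closedBall a R then Ψ.curry ⟨z, h⟩ else 0
  have hΦ : ContinuousOn Φ (closedBall a R) := by
    rw [continuousOn_iff_continuous_domRestrict]
    convert! Ψ.curry.continuous using 1
    ext ⟨z, hz⟩ s
    simp only [Set.domRestrict_apply, Φ, dif_pos hz]
  have hΦv : ∀ z ∈ closedBall a R, ∀ s, Φ z s = f (z, s) := fun z hz s => by
    simp only [Φ, dif_pos hz]
    rfl
  lift R to NNReal using hR.le
  have hint : CircleIntegrable Φ a R :=
    (hΦ.mono sphere_subset_closedBall).circleIntegrable R.coe_nonneg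
  have hG := (hasFPowerSeriesOn_cauchy_integral hint (by exact_mod_cast hR)).analyticAt
  set G : ℂ → C(sphere b R, ℂ) := fun w =>
    (2 * Real.pi * Complex.I : ℂ)⁻¹ • ∮ z in C(a, R), (z - w)⁻¹ • Φ z with hGdef
  have hGv : ∀ z ∈ ball a R, ∀ s, G z s = f (z, s) := by
    intro z hz s
    have h3 : (∮ ζ in C(a, R), (ζ - z)⁻¹ • Φ ζ) s = ∮ ζ in C(a, R), (ζ - z)⁻¹ • f (ζ, s) := by
      have hci : CircleIntegrable (fun ζ => (ζ - z)⁻¹ • Φ ζ) a R := by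
        refine ContinuousOn.circleIntegrable R.coe_nonneg ?_
        refine ContinuousOn.smul (f := fun ζ => (ζ - z)⁻¹)
          (ContinuousOn.inv₀ (f := fun ζ => ζ - z) (by fun_prop) ?_)
          (hΦ.mono sphere_subset_closedBall)
        intro ζ hζ h
        rw [sub_eq_zero] at h
        subst h
        rw [mem_sphere] at hζ
        rw [mem_ball] at hz
        exact hz.ne hζ
      have h4 := (ContinuousMap.evalCLM ℂ s : C(sphere b R, ℂ) →L[ℂ] ℂ).intervalIntegral_comp_comm
        hci.out
      refine Eq.trans ?_ (h4.symm.trans ?_)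
      · rfl
      rw [circleIntegral]
      congr 1 with θ
      simp [hΦv _ (sphere_subset_closedBall (circleMap_mem_sphere a R.coe_nonneg θ))]
    have h5 := Complex.two_pi_I_inv_smul_circleIntegral_sub_inv_smul_of_differentiable_on_off_countable
      Set.countable_empty hz (h1 s (sphere_subset_closedBall s.2)).continuousOn
      (fun x hx => (h1 s (sphere_subset_closedBall s.2)).differentiableAt
        (closedBall_mem_nhds_of_mem hx.1))
    rw [← h5, hGdef, ContinuousMap.smul_apply, h3]
  let K : ℂ → C(sphere b R, ℂ) := fun w => Ring.inverse
      ((⟨Subtype.val, continuous_subtype_val⟩ : C(sphere b R, ℂ)) -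
        algebraMap ℂ C(sphere b R, ℂ) w)
  have hK : AnalyticAt ℂ K b := analyticAt_cauchyKernel b (mem_ball_self hR)
  -- Cauchy's formula in w writes f as a continuous linear functional of the product of an analytic
  -- function of z and an analytic function of w.
  have hH : AnalyticAt ℂ (fun p : ℂ × ℂ => (2 * Real.pi * Complex.I : ℂ)⁻¹ *
      sphereIntegral b hR.le (G p.1 * K p.2)) (a, b) := by
    refine analyticAt_const.mul ?_
    refine AnalyticAt.fun_comp ((sphereIntegral b hR.le).analyticAt _) ?_
    exact (AnalyticAt.fun_comp (f := Prod.fst) (x := (a, b)) hG analyticAt_fst).mul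
      (AnalyticAt.fun_comp (f := Prod.snd) (x := (a, b)) hK analyticAt_snd)
  refine hH.congr ?_
  filter_upwards [prod_mem_nhds (ball_mem_nhds a hR) (ball_mem_nhds b hR)] with p hp
  rw [sphereIntegral_apply hR.le _ (fun ζ => (ζ - p.2)⁻¹ • f (p.1, ζ))]
  · exact Complex.two_pi_I_inv_smul_circleIntegral_sub_inv_smul_of_differentiable_on_off_countable
      Set.countable_empty hp.2 (h2 p.1 (ball_subset_closedBall hp.1)).continuousOn
      (fun x hx => (h2 p.1 (ball_subset_closedBall hp.1)).differentiableAt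
        (closedBall_mem_nhds_of_mem hx.1))
  · intro s
    rw [ContinuousMap.mul_apply, hGv _ hp.1, cauchyKernel_apply hp.2, smul_eq_mul, mul_comm]

end Osgood

/-! ### The product `∏ (1 - qⁿ y)` -/

/-- The infinite product `∏_{n ≥ 0} (1 - qⁿ y)`. -/
def qPoch (q y : ℂ) : ℂ := ∏' n : ℕ, (1 - q ^ n * y)

theorem summable_norm_qPoch {q : ℂ} (hq : ‖q‖ < 1) (y : ℂ) :
    Summable fun n : ℕ => ‖-(q ^ n * y)‖ := by
  simpa using (summable_geometric_of_lt_one (norm_nonneg _) hq).mul_right ‖y‖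

theorem multipliable_qPoch {q : ℂ} (hq : ‖q‖ < 1) (y : ℂ) :
    Multipliable fun n : ℕ => 1 - q ^ n * y := by
  simpa [sub_eq_add_neg] using multipliable_one_add_of_summable (summable_norm_qPoch hq y)

theorem hasProd_qPoch {q : ℂ} (hq : ‖q‖ < 1) (y : ℂ) :
    HasProd (fun n : ℕ => 1 - q ^ n * y) (qPoch q y) :=
  (multipliable_qPoch hq y).hasProd

theorem qPoch_eq_mul {q : ℂ} (hq : ‖q‖ < 1) (y : ℂ) :
    qPoch q y = (1 - y) * qPoch q (q * y) := by
  have h : Multipliable fun n : ℕ => 1 - q ^ (n + 1) * y := by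
    simpa [pow_succ, mul_assoc] using multipliable_qPoch hq (q * y)
  have h2 := tprod_eq_zero_mul' (f := fun n : ℕ => 1 - q ^ n * y) h
  simpa only [qPoch, pow_zero, one_mul, pow_succ, mul_assoc] using h2

theorem qPoch_ne_zero {q y : ℂ} (hq : ‖q‖ < 1) (h : ∀ n : ℕ, q ^ n * y ≠ 1) :
    qPoch q y ≠ 0 := by
  have := tprod_one_add_ne_zero_of_summable (f := fun n : ℕ => -(q ^ n * y))
    (fun n h0 => h n (by linear_combination -h0)) (summable_norm_qPoch hq y)
  simpa [qPoch, sub_eq_add_neg] using this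

theorem pow_succ_ne_one {q : ℂ} (hq : ‖q‖ < 1) (n : ℕ) : q ^ n * q ≠ 1 := by
  intro h
  have := congrArg norm h
  rw [← pow_succ, norm_pow, norm_one] at this
  exact (pow_lt_one₀ (norm_nonneg _) hq n.succ_ne_zero).ne this

theorem qPoch_self_ne_zero {q : ℂ} (hq : ‖q‖ < 1) : qPoch q q ≠ 0 :=
  qPoch_ne_zero hq (pow_succ_ne_one hq)

theorem hasProdLocallyUniformlyOn_qPoch {r M : ℝ} (hr : r < 1) (hr0 : 0 ≤ r) :
    HasProdLocallyUniformlyOn (fun (n : ℕ) (p : ℂ × ℂ) => 1 - p.1 ^ n * p.2)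
      (fun p => qPoch p.1 p.2) (Metric.ball 0 r ×ˢ Metric.ball 0 M) := by
  simp only [qPoch, sub_eq_add_neg]
  refine Summable.hasProdLocallyUniformlyOn_nat_one_add
    (Metric.isOpen_ball.prod Metric.isOpen_ball)
    ((summable_geometric_of_lt_one hr0 hr).mul_right M) (Eventually.of_forall ?_)
    (fun n => by fun_prop)
  rintro n ⟨q, y⟩ ⟨hq, hy⟩
  simp only [mem_ball_zero_iff] at hq hy
  rw [norm_neg, norm_mul, norm_pow]
  gcongr

/-- The partial products are polynomials converging locally uniformly in (q, y), which gives
continuity and holomorphy in each variable; Osgood's lemma then gives joint analyticity. -/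
theorem analyticAt_qPoch {q : ℂ} (hq : ‖q‖ < 1) (y : ℂ) :
    AnalyticAt ℂ (fun p : ℂ × ℂ => qPoch p.1 p.2) (q, y) := by
  obtain ⟨r, hr1, hr2⟩ := exists_between hq
  have hr0 : 0 ≤ r := (norm_nonneg _).trans hr1.le
  have H := hasProdLocallyUniformlyOn_qPoch (M := ‖y‖ + (r - ‖q‖)) hr2 hr0
  have hsub : Metric.closedBall q ((r - ‖q‖) / 2) ×ˢ Metric.closedBall y ((r - ‖q‖) / 2) ⊆
      Metric.ball (0 : ℂ) r ×ˢ Metric.ball (0 : ℂ) (‖y‖ + (r - ‖q‖)) := by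
    refine Set.prod_mono ?_ ?_
    · intro z hz
      rw [mem_closedBall_iff_norm] at hz
      rw [mem_ball_zero_iff]
      have := norm_le_norm_add_norm_sub' z q
      linarith
    · intro z hz
      rw [mem_closedBall_iff_norm] at hz
      rw [mem_ball_zero_iff]
      have := norm_le_norm_add_norm_sub' z y
      linarith
  refine analyticAt_of_separately (R := (r - ‖q‖) / 2) (by linarith) ?_ ?_ ?_
  · refine (TendstoLocallyUniformlyOn.continuousOn H ?_).mono hsub
    exact (Eventually.of_forall fun s => by fun_prop).frequently
  · intro w hw
    have H' := H.comp (fun z : ℂ => (z, w)) (t := Metric.ball 0 r) (fun z hz => ⟨hz, (hsub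
      (⟨Metric.mem_closedBall_self (by linarith), hw⟩ :
        ((q, w) : ℂ × ℂ) ∈ _ ×ˢ _)).2⟩) (by fun_prop)
    refine (TendstoLocallyUniformlyOn.differentiableOn H' (Eventually.of_forall fun s => by
      fun_prop) Metric.isOpen_ball).mono fun z hz => ?_
    exact (hsub (⟨hz, hw⟩ : ((z, w) : ℂ × ℂ) ∈ _ ×ˢ _)).1
  · intro z hz
    have H' := H.comp (fun w : ℂ => (z, w)) (t := Metric.ball 0 (‖y‖ + (r - ‖q‖)))
      (fun w hw => ⟨(hsub (⟨hz, Metric.mem_closedBall_self (by linarith)⟩ :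
        ((z, y) : ℂ × ℂ) ∈ _ ×ˢ _)).1, hw⟩) (by fun_prop)
    refine (TendstoLocallyUniformlyOn.differentiableOn H' (Eventually.of_forall fun s => by
      fun_prop) Metric.isOpen_ball).mono fun w hw => ?_
    exact (hsub (⟨hz, hw⟩ : ((z, w) : ℂ × ℂ) ∈ _ ×ˢ _)).2

/-! ### Upper and lower bounds for the product in terms of 1 / (1 - |q|) -/

theorem norm_qPoch_le {q : ℂ} (hq : ‖q‖ < 1) (y : ℂ) :
    ‖qPoch q y‖ ≤ Real.exp (‖y‖ / (1 - ‖q‖)) := by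
  have h := (hasProd_qPoch hq y).norm
  refine le_of_tendsto h (Eventually.of_forall fun s => ?_)
  calc ∏ n ∈ s, ‖1 - q ^ n * y‖ ≤ ∏ n ∈ s, Real.exp (‖q‖ ^ n * ‖y‖) := by
        refine Finset.prod_le_prod (fun _ _ => norm_nonneg _) fun n _ => ?_
        refine (norm_sub_le _ _).trans ?_
        rw [norm_one, norm_mul, norm_pow, add_comm]
        exact Real.add_one_le_exp _
    _ = Real.exp (∑ n ∈ s, ‖q‖ ^ n * ‖y‖) := (Real.exp_sum _ _).symm
    _ ≤ _ := by
        refine Real.exp_le_exp.mpr ?_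
        have hs := (hasSum_geometric_of_lt_one (norm_nonneg _) hq).mul_right ‖y‖
        rw [inv_mul_eq_div] at hs
        exact sum_le_hasSum s (fun n _ => by positivity) hs

/-- Factor 1 - r^(k+1) as (1 - r) times a geometric sum, each of whose k + 1 terms is at least
r^(k+1). -/
theorem pow_div_one_sub_pow_le {r : ℝ} (h0 : 0 ≤ r) (h1 : r < 1) (k : ℕ) :
    r ^ (k + 1) / (1 - r ^ (k + 1)) ≤ 1 / ((k + 1) * (1 - r)) := by
  have hp : r ^ (k + 1) < 1 := pow_lt_one₀ h0 h1 k.succ_ne_zero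
  rw [div_le_div_iff₀ (by linarith) (by have : 0 < 1 - r := by linarith
                                        positivity)]
  have h2 := mul_neg_geom_sum r (k + 1)
  have h3 : (k + 1 : ℝ) * r ^ (k + 1) ≤ ∑ i ∈ Finset.range (k + 1), r ^ i := by
    have := Finset.card_nsmul_le_sum (Finset.range (k + 1)) (fun i => r ^ i) (r ^ (k + 1))
      fun i hi => pow_le_pow_of_le_one h0 h1.le (Finset.mem_range.mp hi).le
    simpa using this
  have h4 := mul_le_mul_of_nonneg_left h3 (by linarith : 0 ≤ 1 - r)
  rw [h2] at h4
  linarith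

/-- Expand each -log(1 - r^n) as a power series and sum over n first: the k-th terms form a
geometric series of size at most 1 / (k (1 - r)), and the remaining factor 1 / k makes the sum over
k converge to ζ(2) / (1 - r). This controls the denominator of σ. -/
theorem exp_neg_le_prod_one_sub_pow {r : ℝ} (h0 : 0 ≤ r) (h1 : r < 1) (s : Finset ℕ) :
    Real.exp (-((∑' k : ℕ, 1 / ((k + 1 : ℝ) ^ 2)) / (1 - r))) ≤
      ∏ n ∈ s, (1 - r ^ (n + 1)) := by
  have hp : ∀ n : ℕ, r ^ (n + 1) < 1 := fun n => pow_lt_one₀ h0 h1 n.succ_ne_zero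
  have hp0 : ∀ n : ℕ, 0 ≤ r ^ (n + 1) := fun n => pow_nonneg h0 _
  have hlog : ∀ n : ℕ, HasSum (fun k : ℕ => (r ^ (n + 1)) ^ (k + 1) / (k + 1))
      (-Real.log (1 - r ^ (n + 1))) := fun n =>
    Real.hasSum_pow_div_log_of_abs_lt_one (by rw [abs_of_nonneg (hp0 n)]; exact hp n)
  have hsum := hasSum_sum (s := s) fun n _ => hlog n
  have hK : Summable fun k : ℕ => 1 / ((k + 1 : ℝ) ^ 2) := by
    have := (summable_nat_add_iff 1).mpr (Real.summable_one_div_nat_pow.mpr one_lt_two)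
    simpa using this
  have hle : ∑ n ∈ s, -Real.log (1 - r ^ (n + 1)) ≤
      (∑' k : ℕ, 1 / ((k + 1 : ℝ) ^ 2)) / (1 - r) := by
    refine hasSum_le (fun k => ?_) hsum (hK.hasSum.div_const _)
    have h2 : ∑ n ∈ s, (r ^ (n + 1)) ^ (k + 1) ≤ r ^ (k + 1) / (1 - r ^ (k + 1)) := by
      have hg := (hasSum_geometric_of_lt_one (hp0 k) (hp k)).mul_left (r ^ (k + 1))
      rw [← div_eq_mul_inv] at hg
      refine le_trans (le_of_eq ?_) (sum_le_hasSum s (fun n _ => by positivity) hg)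
      refine Finset.sum_congr rfl fun n _ => ?_
      ring
    rw [← Finset.sum_div]
    have h3 := h2.trans (pow_div_one_sub_pow_le h0 h1 k)
    calc _ ≤ (1 / ((k + 1) * (1 - r))) / (k + 1) := by gcongr
      _ = _ := by
        have : 1 - r ≠ 0 := by linarith
        field_simp
  calc _ ≤ Real.exp (-∑ n ∈ s, -Real.log (1 - r ^ (n + 1))) :=
        Real.exp_le_exp.mpr (neg_le_neg hle)
    _ = _ := by
      rw [Finset.sum_neg_distrib, neg_neg, Real.exp_sum]
      exact Finset.prod_congr rfl fun n _ => Real.exp_log (by linarith [hp n])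

theorem exp_neg_le_norm_qPoch_self {q : ℂ} (hq : ‖q‖ < 1) :
    Real.exp (-((∑' k : ℕ, 1 / ((k + 1 : ℝ) ^ 2)) / (1 - ‖q‖))) ≤ ‖qPoch q q‖ := by
  refine ge_of_tendsto (hasProd_qPoch hq q).norm (Eventually.of_forall fun s => ?_)
  refine (exp_neg_le_prod_one_sub_pow (norm_nonneg q) hq s).trans ?_
  refine Finset.prod_le_prod (fun n _ => ?_) fun n _ => ?_
  · exact sub_nonneg.mpr (pow_lt_one₀ (norm_nonneg q) hq n.succ_ne_zero).le
  · have := norm_sub_norm_le 1 (q ^ n * q)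
    rwa [norm_one, ← pow_succ, norm_pow] at this

/-! ### The sigma function -/

theorem mem_lattice_iff {τ : ℍ} {w : ℂ} : w ∈ lattice τ ↔ ∃ a b : ℤ, w = a + b * (τ : ℂ) := by
  simp [lattice, AddSubgroup.mem_closure_pair, eq_comm]

/-- The nome `q = exp (2πiτ)`. -/
def nome (τ : ℍ) : ℂ := Complex.exp (2 * Real.pi * Complex.I * τ)

theorem norm_nome_lt_one (τ : ℍ) : ‖nome τ‖ < 1 := UpperHalfPlane.norm_exp_two_pi_I_lt_one τ

theorem sigma_eq (τ : ℍ) (z : ℂ) :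
    sigma τ z = (Complex.exp (Real.pi * Complex.I * z) - Complex.exp (-(Real.pi * Complex.I * z))) *
      (qPoch (nome τ) (nome τ * Complex.exp (2 * Real.pi * Complex.I * z)) *
        qPoch (nome τ) (nome τ * Complex.exp (-(2 * Real.pi * Complex.I * z))) /
        qPoch (nome τ) (nome τ) ^ 2) := by
  have hq := norm_nome_lt_one τ
  rw [sigma]
  congr 1
  refine HasProd.tprod_eq ?_
  have h1 := hasProd_qPoch hq (nome τ * Complex.exp (2 * Real.pi * Complex.I * z))
  have h2 := hasProd_qPoch hq (nome τ * Complex.exp (-(2 * Real.pi * Complex.I * z)))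
  have h3 := hasProd_qPoch hq (nome τ)
  have h := Tendsto.div (h1.mul h2) (Tendsto.pow h3 2)
    (pow_ne_zero 2 (qPoch_self_ne_zero hq))
  refine Tendsto.congr (fun s => ?_) h
  simp only [Pi.div_apply]
  rw [← Finset.prod_pow, ← Finset.prod_div_distrib]
  refine Finset.prod_congr rfl fun n _ => ?_
  simp only [nome, pow_succ, mul_assoc]

theorem analyticAt_nome {τ : ℍ} :
    AnalyticAt ℂ (fun z : ℂ => nome (UpperHalfPlane.ofComplex z)) (τ : ℂ) := by
  have h : AnalyticAt ℂ (fun z : ℂ => Complex.exp (2 * Real.pi * Complex.I * z)) (τ : ℂ) := by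
    fun_prop
  refine h.congr ?_
  filter_upwards [UpperHalfPlane.isOpen_upperHalfPlaneSet.mem_nhds τ.2] with z hz
  rw [nome, UpperHalfPlane.ofComplex_apply_of_im_pos hz]

theorem holAt_sigma (τ : ℍ) (z : ℂ) : HolAt sigma τ z := by
  have hq := norm_nome_lt_one τ
  have hN : AnalyticAt ℂ (fun p : ℂ × ℂ => nome (UpperHalfPlane.ofComplex p.1)) ((τ : ℂ), z) :=
    AnalyticAt.fun_comp (f := Prod.fst) (x := ((τ : ℂ), z)) analyticAt_nome analyticAt_fst
  have hA : ∀ g : ℂ × ℂ → ℂ, AnalyticAt ℂ g ((τ : ℂ), z) → AnalyticAt ℂ (fun p : ℂ × ℂ =>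
      qPoch (nome (UpperHalfPlane.ofComplex p.1)) (g p)) ((τ : ℂ), z) := fun g hg => by
    refine AnalyticAt.fun_comp (g := fun p : ℂ × ℂ => qPoch p.1 p.2) ?_ (hN.prod hg)
    exact analyticAt_qPoch (by simpa using hq) _
  have hsnd : AnalyticAt ℂ (fun p : ℂ × ℂ => p.2) ((τ : ℂ), z) := analyticAt_snd
  have he : ∀ c : ℂ, AnalyticAt ℂ (fun p : ℂ × ℂ => Complex.exp (c * p.2)) ((τ : ℂ), z) :=
    fun c => (analyticAt_const.mul hsnd).cexp
  simp only [HolAt, sigma_eq, ← neg_mul]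
  refine ((he _).sub (he _)).mul (((hA _ (hN.mul (he _))).mul (hA _ (hN.mul (he _)))).div
    ((hA _ hN).pow 2) ?_)
  simpa using pow_ne_zero 2 (qPoch_self_ne_zero hq)

theorem HolAt.analyticAt_right {E : Type*} [NormedAddCommGroup E] [NormedSpace ℂ E]
    {f : ℍ → E → ℂ} {τ : ℍ} {x : E} (h : HolAt f τ x) : AnalyticAt ℂ (f τ) x := by
  have h2 : AnalyticAt ℂ (fun y : E => ((τ : ℂ), y)) x := analyticAt_const.prod analyticAt_id
  have := AnalyticAt.fun_comp (f := fun y : E => ((τ : ℂ), y)) h h2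
  simpa using this

theorem analyticAt_sigma (τ : ℍ) (z : ℂ) : AnalyticAt ℂ (sigma τ) z :=
  (holAt_sigma τ z).analyticAt_right

theorem differentiable_sigma (τ : ℍ) : Differentiable ℂ (sigma τ) :=
  fun z => (analyticAt_sigma τ z).differentiableAt

theorem sigma_zero (τ : ℍ) : sigma τ 0 = 0 := by simp [sigma]

/-- Only the prefactor vanishes at 0, and the infinite product equals 1 there. The independence of τ
later makes this value a unit of O(U). -/
theorem deriv_sigma_zero (τ : ℍ) : deriv (sigma τ) 0 = 2 * Real.pi * Complex.I := by
  have hq := norm_nome_lt_one τ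
  have hs : sigma τ = fun z => (Complex.exp (Real.pi * Complex.I * z) -
      Complex.exp (-(Real.pi * Complex.I * z))) *
      (qPoch (nome τ) (nome τ * Complex.exp (2 * Real.pi * Complex.I * z)) *
        qPoch (nome τ) (nome τ * Complex.exp (-(2 * Real.pi * Complex.I * z))) /
        qPoch (nome τ) (nome τ) ^ 2) := funext (sigma_eq τ)
  have hA : ∀ c : ℂ, DifferentiableAt ℂ (fun z : ℂ =>
      qPoch (nome τ) (nome τ * Complex.exp (c * z))) 0 := fun c => by
    have h1 := (analyticAt_qPoch hq (nome τ * Complex.exp (c * 0))).differentiableAt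
    have h2 : DifferentiableAt ℂ (fun z : ℂ => (nome τ, nome τ * Complex.exp (c * z))) 0 := by
      fun_prop
    exact DifferentiableAt.fun_comp' (g := fun p : ℂ × ℂ => qPoch p.1 p.2) (0 : ℂ) h1 h2
  have hB : DifferentiableAt ℂ (fun z : ℂ =>
      (qPoch (nome τ) (nome τ * Complex.exp (2 * Real.pi * Complex.I * z)) *
        qPoch (nome τ) (nome τ * Complex.exp (-(2 * Real.pi * Complex.I * z))) /
        qPoch (nome τ) (nome τ) ^ 2)) 0 := by
    simp only [← neg_mul]
    exact ((hA _).mul (hA _)).div_const _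
  have hC : HasDerivAt (fun z : ℂ => Complex.exp (Real.pi * Complex.I * z) -
      Complex.exp (-(Real.pi * Complex.I * z))) (2 * Real.pi * Complex.I) 0 := by
    have h1 := ((hasDerivAt_id (0 : ℂ)).const_mul (Real.pi * Complex.I : ℂ)).cexp
    have h2 := ((hasDerivAt_id (0 : ℂ)).const_mul (Real.pi * Complex.I : ℂ)).neg.cexp
    convert! h1.sub h2 using 1
    simp
    ring
  rw [hs, (hC.fun_mul hB.hasDerivAt).deriv]
  have := qPoch_self_ne_zero hq
  simp
  field_simp

theorem sigma_add_one (τ : ℍ) (z : ℂ) : sigma τ (z + 1) = -sigma τ z := by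
  have h1 : Complex.exp (Real.pi * Complex.I * (z + 1)) =
      -Complex.exp (Real.pi * Complex.I * z) := by
    rw [mul_add, Complex.exp_add, mul_one, Complex.exp_pi_mul_I]; ring
  have h2 : Complex.exp (-(Real.pi * Complex.I * (z + 1))) =
      -Complex.exp (-(Real.pi * Complex.I * z)) := by
    rw [Complex.exp_neg, h1, Complex.exp_neg, inv_neg]
  have h3 : Complex.exp (2 * Real.pi * Complex.I * (z + 1)) =
      Complex.exp (2 * Real.pi * Complex.I * z) := by
    rw [mul_add, Complex.exp_add, mul_one, Complex.exp_two_pi_mul_I, mul_one]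
  have h4 : Complex.exp (-(2 * Real.pi * Complex.I * (z + 1))) =
      Complex.exp (-(2 * Real.pi * Complex.I * z)) := by
    rw [Complex.exp_neg, h3, Complex.exp_neg]
  rw [sigma, sigma, h1, h2, h3, h4]
  ring

theorem sigma_add_tau (τ : ℍ) (z : ℂ) :
    sigma τ (z + τ) = -Complex.exp (-(Real.pi * Complex.I * (τ + 2 * z))) * sigma τ z := by
  have hq := norm_nome_lt_one τ
  set T := Complex.exp (Real.pi * Complex.I * τ) with hT
  set E := Complex.exp (Real.pi * Complex.I * z) with hE
  have hT0 : T ≠ 0 := Complex.exp_ne_zero _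
  have hE0 : E ≠ 0 := Complex.exp_ne_zero _
  have hn : nome τ = T ^ 2 := by rw [nome, hT, ← Complex.exp_nat_mul]; ring_nf
  have h1 : Complex.exp (Real.pi * Complex.I * (z + τ)) = E * T := by
    rw [mul_add, Complex.exp_add]
  have h2 : Complex.exp (2 * Real.pi * Complex.I * (z + τ)) = E ^ 2 * T ^ 2 := by
    rw [hT, hE, ← Complex.exp_nat_mul, ← Complex.exp_nat_mul, ← Complex.exp_add]; ring_nf
  have h3 : Complex.exp (2 * Real.pi * Complex.I * z) = E ^ 2 := by
    rw [hE, ← Complex.exp_nat_mul]; ring_nf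
  have h4 : Complex.exp (-(Real.pi * Complex.I * (τ + 2 * z))) = T⁻¹ * (E⁻¹) ^ 2 := by
    rw [hT, hE, ← Complex.exp_neg, ← Complex.exp_neg, ← Complex.exp_nat_mul, ← Complex.exp_add]
    ring_nf
  rw [sigma_eq, sigma_eq, h4]
  simp only [Complex.exp_neg, h1, h2, h3, hn, ← hE]
  rw [hn] at hq
  -- Translation by τ replaces y by qy: the product in y loses its first factor, the one in y⁻¹
  -- gains a factor, and these two combine with the prefactor.
  have h5 := qPoch_eq_mul hq (T ^ 2 * E ^ 2)
  have h6 := qPoch_eq_mul hq ((E ^ 2)⁻¹)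
  have h7 : T ^ 2 * (E ^ 2 * T ^ 2)⁻¹ = (E ^ 2)⁻¹ := by field_simp
  have h8 : T ^ 2 * (E ^ 2 * T ^ 2) = T ^ 2 * (T ^ 2 * E ^ 2) := by ring
  rw [h7, h8, h5, h6]
  have := qPoch_self_ne_zero hq
  field_simp
  ring

/-- The automorphy factor of `σ` for translation by `a + bτ`. -/
theorem sigma_add_lattice (τ : ℍ) (a b : ℤ) (z : ℂ) :
    sigma τ (z + (a + b * τ)) = Complex.exp (Real.pi * Complex.I * (a + b) -
      Real.pi * Complex.I * b ^ 2 * τ - 2 * Real.pi * Complex.I * b * z) * sigma τ z := by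
  have hstep1 : ∀ z, sigma τ (z + 1) = Complex.exp (Real.pi * Complex.I) * sigma τ z := fun z => by
    rw [sigma_add_one, Complex.exp_pi_mul_I]; ring
  have hstep2 : ∀ z, sigma τ (z + τ) = Complex.exp (Real.pi * Complex.I -
      Real.pi * Complex.I * (τ + 2 * z)) * sigma τ z := fun z => by
    rw [sigma_add_tau, sub_eq_add_neg, Complex.exp_add, Complex.exp_pi_mul_I]; ring
  have hA : ∀ (a : ℤ) (z : ℂ), sigma τ (z + a) =
      Complex.exp (Real.pi * Complex.I * a) * sigma τ z := by
    intro a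
    induction a using Int.induction_on with
    | zero => simp
    | succ n ih =>
      intro z
      have := hstep1 (z + n)
      push_cast at ih ⊢
      rw [← add_assoc, this, ih, ← mul_assoc, ← Complex.exp_add]
      ring_nf
    | pred n ih =>
      intro z
      have := hstep1 (z + (-n - 1 : ℤ))
      push_cast at ih this ⊢
      rw [show z + (-(n : ℂ) - 1) + 1 = z + -n by ring, ih] at this
      rw [show Real.pi * Complex.I * (-(n : ℂ) - 1) =
        Real.pi * Complex.I * (-(n : ℂ)) + -(Real.pi * Complex.I) by ring, Complex.exp_add,
        mul_assoc, mul_left_comm, this, ← mul_assoc, ← Complex.exp_add]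
      simp
  have hB : ∀ (b : ℤ) (z : ℂ), sigma τ (z + b * τ) = Complex.exp (Real.pi * Complex.I * b -
      Real.pi * Complex.I * b ^ 2 * τ - 2 * Real.pi * Complex.I * b * z) * sigma τ z := by
    intro b
    induction b using Int.induction_on with
    | zero => simp
    | succ n ih =>
      intro z
      have := hstep2 (z + n * τ)
      push_cast at ih ⊢
      rw [add_mul, one_mul, ← add_assoc, this, ih, ← mul_assoc, ← Complex.exp_add]
      ring_nf
    | pred n ih =>
      intro z
      have := hstep2 (z + (-n - 1 : ℤ) * τ)
      push_cast at ih this ⊢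
      rw [show z + (-(n : ℂ) - 1) * τ + τ = z + -n * τ by ring, ih] at this
      have h2 := congrArg (fun u => Complex.exp (-(Real.pi * Complex.I -
        Real.pi * Complex.I * (τ + 2 * (z + (-(n : ℂ) - 1) * τ)))) * u) this
      simp only [← mul_assoc, ← Complex.exp_add] at h2
      rw [neg_add_cancel, Complex.exp_zero, one_mul] at h2
      rw [← h2]
      ring_nf
  rw [add_comm (a : ℂ), ← add_assoc, hA, hB, ← mul_assoc, ← Complex.exp_add]
  ring_nf

/-- An absolutely convergent product vanishes only if a factor does. The prefactor accounts for the
integers, the factors 1 - qⁿy^{±1} for the lattice points with nonzero τ-coefficient. Conversely,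
quasi-periodicity carries the zero at 0 to the whole lattice. -/
theorem sigma_eq_zero_iff (τ : ℍ) (z : ℂ) : sigma τ z = 0 ↔ z ∈ lattice τ := by
  have hq := norm_nome_lt_one τ
  constructor
  · intro h
    by_contra hz
    rw [mem_lattice_iff] at hz
    push Not at hz
    rw [sigma_eq] at h
    have hpi : (2 * Real.pi * Complex.I : ℂ) ≠ 0 := by
      simp [Real.pi_ne_zero, Complex.I_ne_zero]
    have hexp : ∀ u : ℂ, Complex.exp (2 * Real.pi * Complex.I * u) = 1 → ∃ n : ℤ, u = n := by
      intro u hu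
      obtain ⟨n, hn⟩ := Complex.exp_eq_one_iff.mp hu
      exact ⟨n, mul_left_cancel₀ hpi (by rw [hn]; ring)⟩
    have hpow : ∀ (n : ℕ) (s : ℂ), nome τ ^ n * (nome τ * Complex.exp (s)) =
        Complex.exp ((n + 1) * (2 * Real.pi * Complex.I * τ) + s) := fun n s => by
      rw [← mul_assoc, ← pow_succ, nome, ← Complex.exp_nat_mul, ← Complex.exp_add]
      push_cast
      ring_nf
    rcases mul_eq_zero.mp h with h | h
    · have h1 : Complex.exp (2 * Real.pi * Complex.I * z) = 1 := by
        have h2 := sub_eq_zero.mp h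
        have h3 := congrArg (fun u => Complex.exp (Real.pi * Complex.I * z) * u) h2
        simp only [← Complex.exp_add] at h3
        rw [add_neg_cancel, Complex.exp_zero] at h3
        rw [← h3]
        ring_nf
      obtain ⟨n, hn⟩ := hexp z h1
      exact hz n 0 (by simp [hn])
    · rcases div_eq_zero_iff.mp h with h | h
      · rcases mul_eq_zero.mp h with h | h
        · refine qPoch_ne_zero hq (fun n hn => ?_) h
          rw [hpow] at hn
          obtain ⟨m, hm⟩ := hexp ((n + 1) * τ + z) (by refine Eq.trans ?_ hn; congr 1; ring)
          exact hz m (-(n + 1)) (by push_cast; linear_combination hm)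
        · refine qPoch_ne_zero hq (fun n hn => ?_) h
          rw [hpow] at hn
          obtain ⟨m, hm⟩ := hexp ((n + 1) * τ - z) (by refine Eq.trans ?_ hn; congr 1; ring)
          exact hz (-m) (n + 1) (by push_cast; linear_combination -hm)
      · exact qPoch_self_ne_zero hq (by simpa using h)
  · intro h
    obtain ⟨a, b, rfl⟩ := mem_lattice_iff.mp h
    have := sigma_add_lattice τ a b 0
    rw [zero_add, sigma_zero, mul_zero] at this
    exact this

/-- The exponent of the automorphy factor of `σ`. -/
def autExp (τ : ℍ) (a b : ℤ) (z : ℂ) : ℂ := Real.pi * Complex.I * (a + b) -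
      Real.pi * Complex.I * b ^ 2 * τ - 2 * Real.pi * Complex.I * b * z

theorem add_lattice_mem_iff {τ : ℍ} (a b : ℤ) {w : ℂ} :
    w + (a + b * τ) ∈ lattice τ ↔ w ∈ lattice τ :=
  AddSubgroup.add_mem_cancel_right _ (mem_lattice_iff.mpr ⟨a, b, rfl⟩)

/-- Linearity of the fibre of O(-0) over functions: at a lattice point the Leibniz term h'g drops
out because g vanishes. -/
theorem fibreValue_mul_of_mem {τ : ℍ} {h g : ℂ → ℂ} {w : ℂ} (hh : DifferentiableAt ℂ h w)
    (hg : DifferentiableAt ℂ g w) (h0 : w ∈ lattice τ → g w = 0) :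
    fibreValue τ (fun z => h z * g z) w = h w * fibreValue τ g w := by
  unfold fibreValue
  split_ifs with hw
  · rw [deriv_fun_mul hh hg, h0 hw]; ring
  · rfl

theorem fibreValue_sigma_add_lattice (τ : ℍ) (a b : ℤ) (w : ℂ) :
    fibreValue τ (sigma τ) (w + (a + b * τ)) =
      Complex.exp (autExp τ a b w) * fibreValue τ (sigma τ) w := by
  rw [← fibreValue_mul_of_mem (h := fun z => Complex.exp (autExp τ a b z))
    (by unfold autExp; fun_prop) (differentiable_sigma τ w) fun hw => (sigma_eq_zero_iff τ w).mpr hw]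
  have h1 : (fun z => Complex.exp (autExp τ a b z) * sigma τ z) =
      fun z => sigma τ (z + (a + b * τ)) := funext fun z => (sigma_add_lattice τ a b z).symm
  rw [h1]
  unfold fibreValue
  rw [deriv_comp_add_const]
  have h2 := add_lattice_mem_iff (τ := τ) a b (w := w)
  by_cases hw : w ∈ lattice τ
  · rw [if_pos (h2.mpr hw), if_pos hw]
  · rw [if_neg (mt h2.mp hw), if_neg hw]

/-- The zero at 0 is simple and the automorphy factors never vanish, so all zeros are simple and σ
is a global generator of O(-0) on the cover. -/
theorem fibreValue_sigma_ne_zero (τ : ℍ) (w : ℂ) : fibreValue τ (sigma τ) w ≠ 0 := by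
  by_cases hw : w ∈ lattice τ
  · obtain ⟨a, b, rfl⟩ := mem_lattice_iff.mp hw
    have := fibreValue_sigma_add_lattice τ a b 0
    rw [zero_add] at this
    rw [this]
    refine mul_ne_zero (Complex.exp_ne_zero _) ?_
    rw [fibreValue, if_pos (zero_mem _), deriv_sigma_zero]
    simp [Real.pi_ne_zero, Complex.I_ne_zero]
  · rw [fibreValue, if_neg hw]
    exact fun h => hw ((sigma_eq_zero_iff τ w).mp h)

/-! ### The cubical structure -/

theorem cube_mul (f g : Finset (Fin 3) → ℂ) :
    cube (fun I => f I * g I) = cube f * cube g := by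
  simp only [cube, mul_inv]
  ring

theorem cube_ne_zero {f : Finset (Fin 3) → ℂ} (h : ∀ I, f I ≠ 0) : cube f ≠ 0 := by
  simp [cube, h]

theorem cube_exp (f : Finset (Fin 3) → ℂ) :
    cube (fun I => Complex.exp (f I)) = Complex.exp (f {0, 1, 2} + f {0} + f {1} + f {2} -
      (f {0, 1} + f {0, 2} + f {1, 2} + f ∅)) := by
  simp only [cube, ← Complex.exp_add, ← Complex.exp_neg, sub_eq_add_neg]

theorem sum_fin3 {M : Type*} [AddCommMonoid M] (f : Fin 3 → M) :
    (∑ i ∈ ({0, 1, 2} : Finset (Fin 3)), f i = f 0 + f 1 + f 2) ∧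
    (∑ i ∈ ({0, 1} : Finset (Fin 3)), f i = f 0 + f 1) ∧
    (∑ i ∈ ({0, 2} : Finset (Fin 3)), f i = f 0 + f 2) ∧
    (∑ i ∈ ({1, 2} : Finset (Fin 3)), f i = f 1 + f 2) := by
  refine ⟨?_, ?_, ?_, ?_⟩ <;> simp [add_assoc]

/-- The third difference of a quadratic polynomial is zero; this is the theorem of the cube at the
level of exponents. -/
theorem cube_exp_quadratic (A B C : ℂ) (x : Fin 3 → ℂ) :
    cube (fun I => Complex.exp (A + B * psum I x + C * psum I x ^ 2)) = 1 := by
  rw [cube_exp, ← Complex.exp_zero]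
  congr 1
  simp only [psum, sum_fin3, Finset.sum_singleton, Finset.sum_empty]
  ring

/-- The cube of `σ`, as a function on the cover of the triple fibre product. -/
def cubeSigma (τ : ℍ) (x : Fin 3 → ℂ) : ℂ :=
  cube fun I => fibreValue τ (sigma τ) (psum I x)

theorem cubeSigma_ne_zero (τ : ℍ) (x : Fin 3 → ℂ) : cubeSigma τ x ≠ 0 :=
  cube_ne_zero fun _ => fibreValue_sigma_ne_zero τ _

theorem proj_eq_iff {τ : ℍ} {x y : Fin 3 → ℂ} :
    proj τ x = proj τ y ↔ ∀ i, ∃ a b : ℤ, y i = x i + (a + b * τ) := by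
  simp only [proj, funext_iff, QuotientAddGroup.eq, mem_lattice_iff]
  refine forall_congr' fun i => exists_congr fun a => exists_congr fun b => ?_
  constructor <;> intro h <;> linear_combination h

theorem proj_surjective (τ : ℍ) : Function.Surjective (proj τ) := fun p =>
  ⟨fun i => (p i).out, funext fun _ => QuotientAddGroup.out_eq' _⟩

theorem cubeSigma_eq_of_proj_eq {τ : ℍ} {x y : Fin 3 → ℂ} (h : proj τ x = proj τ y) :
    cubeSigma τ y = cubeSigma τ x := by
  choose a b hab using proj_eq_iff.mp h
  have hp : ∀ I, psum I y = psum I x + ((∑ i ∈ I, a i : ℤ) + (∑ i ∈ I, b i : ℤ) * τ) := fun I => by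
    simp only [psum, hab, Finset.sum_add_distrib]
    push_cast
    rw [Finset.sum_mul]
  simp only [cubeSigma, hp, fibreValue_sigma_add_lattice, cube_mul, cube_exp]
  convert one_mul _
  rw [← Complex.exp_zero]
  congr 1
  -- The exponent is quadratic in the partial sums of a, b and x jointly, all additive in I, so its
  -- third difference vanishes even when the translations differ from coordinate to coordinate.
  simp only [psum, autExp, sum_fin3, Finset.sum_singleton, Finset.sum_empty]
  push_cast
  ring

theorem fibreValue_upsilon (τ : ℍ) (w : ℂ) : fibreValue τ (upsilon τ) w =
    Complex.exp (Real.pi * Complex.I + Real.pi * Complex.I * w + 0 * w ^ 2) *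
      fibreValue τ (sigma τ) w := by
  rw [zero_mul, add_zero, Complex.exp_add, Complex.exp_pi_mul_I, neg_one_mul]
  exact fibreValue_mul_of_mem (h := fun z => -Complex.exp (Real.pi * Complex.I * z))
    (by fun_prop) (differentiable_sigma τ w) fun hw => (sigma_eq_zero_iff τ w).mpr hw

theorem cube_upsilon (τ : ℍ) (x : Fin 3 → ℂ) :
    cube (fun I => fibreValue τ (upsilon τ) (psum I x)) = cubeSigma τ x := by
  simp only [fibreValue_upsilon, cube_mul, cube_exp_quadratic, one_mul, cubeSigma]

/-! ### The Euler class of V₃ -/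

/-- The character of `U(1)³` belonging to a set of coordinates. -/
def charOf (I : Finset (Fin 3)) : Fin 3 → ℤ := fun i => if i ∈ I then 1 else 0

theorem charOf_injective : Function.Injective charOf := fun I J h => by
  ext i
  have := congrFun h i
  simp only [charOf] at this
  split_ifs at this <;> simp_all

theorem charOf_sum (I : Finset (Fin 3)) (x : Fin 3 → ℂ) :
    ∑ i, (charOf I i : ℂ) * x i = psum I x := by
  simp [charOf, psum, Finset.sum_ite_mem]

theorem prod_L (I : Finset (Fin 3)) :
    ∏ i ∈ I, L i = AddMonoidAlgebra.single (charOf I) (1 : ℤ) := by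
  induction I using Finset.induction_on with
  | empty => rfl
  | insert i I hi ih =>
    rw [Finset.prod_insert hi, ih, L, AddMonoidAlgebra.single_mul_single, one_mul]
    congr 1
    ext j
    by_cases h : j = i
    · subst h; simp [charOf, hi]
    · simp [charOf, h]

theorem V₃_eq : V₃ = ∑ I : Finset (Fin 3),
    AddMonoidAlgebra.single (charOf I) ((-1 : ℤ) ^ Iᶜ.card) := by
  have h1 : V₃ = ∏ i : Fin 3, (L i + -1) := by
    simp [V₃, Fin.prod_univ_three, sub_eq_add_neg]
  rw [h1, Finset.prod_add, Finset.powerset_univ]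
  refine Finset.sum_congr rfl fun I _ => ?_
  rw [prod_L, Finset.prod_const, ← Finset.compl_eq_univ_sdiff]
  rcases neg_one_pow_eq_or ℤ Iᶜ.card with h | h
  · rw [h, ← Int.cast_one (R := RepRing), ← Int.cast_neg, ← Int.cast_pow, h]; simp
  · rw [h, ← Int.cast_one (R := RepRing), ← Int.cast_neg, ← Int.cast_pow, h]
    simp

theorem V₃_coeff_charOf (I : Finset (Fin 3)) : V₃.coeff (charOf I) = (-1 : ℤ) ^ Iᶜ.card := by
  rw [V₃_eq, AddMonoidAlgebra.coeff_sum, Finsupp.finsetSum_apply, Finset.sum_eq_single I]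
  · simp
  · intro J _ hJ
    simp [charOf_injective.ne hJ]
  · simp

theorem V₃_coeff_support : V₃.coeff.support ⊆ Finset.univ.image charOf := by
  intro χ hχ
  by_contra h
  rw [Finsupp.mem_support_iff, V₃_eq, AddMonoidAlgebra.coeff_sum, Finsupp.finsetSum_apply] at hχ
  refine hχ (Finset.sum_eq_zero fun I _ => ?_)
  have : charOf I ≠ χ := fun h2 => h (h2 ▸ Finset.mem_image_of_mem _ (Finset.mem_univ I))
  simp [this]

theorem eulerClass_V₃ (τ : ℍ) (x : Fin 3 → ℂ) : eulerClass V₃ τ x = cubeSigma τ x := by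
  have h : (Finset.univ : Finset (Finset (Fin 3))) =
      {{0, 1, 2}, {0}, {1}, {2}, {0, 1}, {0, 2}, {1, 2}, ∅} := by decide
  -- The product runs over all eight characters `charOf I`; the exponent (-1)^|Iᶜ| puts each factor
  -- in the numerator or the denominator of the cube.
  rw [eulerClass, Finsupp.prod_of_support_subset _ V₃_coeff_support _ (fun _ _ => zpow_zero _),
    Finset.prod_image charOf_injective.injOn, ← cube_upsilon]
  simp only [charOf_sum, V₃_coeff_charOf]
  rw [h]
  have c : (({0, 1, 2} : Finset (Fin 3))ᶜ.card = 0) ∧ (({0} : Finset (Fin 3))ᶜ.card = 2) ∧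
    (({1} : Finset (Fin 3))ᶜ.card = 2) ∧ (({2} : Finset (Fin 3))ᶜ.card = 2) ∧
    (({0, 1} : Finset (Fin 3))ᶜ.card = 1) ∧ (({0, 2} : Finset (Fin 3))ᶜ.card = 1) ∧
    (({1, 2} : Finset (Fin 3))ᶜ.card = 1) ∧ ((∅ : Finset (Fin 3))ᶜ.card = 3) := by decide
  obtain ⟨c1, c2, c3, c4, c5, c6, c7, c8⟩ := c
  repeat rw [Finset.prod_insert (by decide)]
  rw [Finset.prod_singleton, c1, c2, c3, c4, c5, c6, c7, c8]
  norm_num [cube]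
  ring

/-- The section of `Θ³(O(-0))` given by the cube of `σ`. -/
def sigmaClass (U : Set ℍ) : TwistedClass U where
  toFun τ p := cubeSigma τ.1 fun i => (p i).out
  hol τ₀ x₀ := by
    -- In the frame given by σ itself the section has coefficient 1.
    refine ⟨fun _ => sigma, fun _ _ => 1, fun I => ⟨holAt_sigma _ _, ?_, ?_⟩, analyticAt_const, ?_⟩
    · exact Eventually.of_forall fun p hp => (sigma_eq_zero_iff _ _).mpr hp
    · exact fibreValue_sigma_ne_zero _ _
    · refine Eventually.of_forall fun p hp => ?_
      rw [one_mul]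
      exact cubeSigma_eq_of_proj_eq (funext fun _ => (QuotientAddGroup.out_eq' _).symm)

theorem sigmaClass_apply {U : Set ℍ} (τ : U) (x : Fin 3 → ℂ) :
    (sigmaClass U).toFun τ (proj τ.1 x) = cubeSigma τ.1 x :=
  cubeSigma_eq_of_proj_eq (funext fun _ => (QuotientAddGroup.out_eq' _).symm)

/-! ### Generators of the ideal sheaf on a fibre -/

/-- Discreteness of the lattice follows from isolation of the zeros of σ. -/
theorem eventually_notMem_lattice (τ : ℍ) (w₀ : ℂ) : ∀ᶠ w in 𝓝[≠] w₀, w ∉ lattice τ := by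
  have h := (analyticAt_sigma τ w₀).eventually_eq_zero_or_eventually_ne_zero
  rcases h with h | h
  · exfalso
    have h1 : sigma τ = 0 := AnalyticOnNhd.eq_of_eventuallyEq (z₀ := w₀)
      (fun z _ => analyticAt_sigma τ z) (fun z _ => analyticAt_const) h
    refine fibreValue_sigma_ne_zero τ 0 ?_
    rw [fibreValue, if_pos (zero_mem _), h1]
    simp
  · filter_upwards [h] with w hw hmem
    exact hw ((sigma_eq_zero_iff τ w).mpr hmem)

/-- Two generators of `O(-0)` on a fibre differ by a unit. -/
theorem exists_analyticAt_fibreValue_eq_mul {τ : ℍ} {w₀ : ℂ} {g h : ℂ → ℂ}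
    (hg : AnalyticAt ℂ g w₀) (hh : AnalyticAt ℂ h w₀)
    (hg0 : w₀ ∈ lattice τ → g w₀ = 0) (hh0 : w₀ ∈ lattice τ → h w₀ = 0)
    (hne : fibreValue τ h w₀ ≠ 0) :
    ∃ r : ℂ → ℂ, AnalyticAt ℂ r w₀ ∧
      ∀ᶠ w in 𝓝 w₀, fibreValue τ g w = r w * fibreValue τ h w := by
  have hlat := eventually_nhdsWithin_iff.mp (eventually_notMem_lattice τ w₀)
  by_cases hw : w₀ ∈ lattice τ
  -- Dividing both functions by w - w₀ handles the two branches of `fibreValue` at once: `dslope` is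
  -- the derivative at w₀ and the difference quotient nearby.
  · have hds : ∀ {f : ℂ → ℂ}, AnalyticAt ℂ f w₀ → AnalyticAt ℂ (dslope f w₀) w₀ := fun hf => by
      obtain ⟨p, hp⟩ := hf
      exact ⟨_, hp.has_fpower_series_dslope_fslope⟩
    have hne' : dslope h w₀ w₀ ≠ 0 := by
      rwa [dslope_same, ← (if_pos hw : fibreValue τ h w₀ = _)]
    refine ⟨fun w => dslope g w₀ w / dslope h w₀ w, (hds hg).div (hds hh) hne', ?_⟩
    filter_upwards [hlat, (hds hh).continuousAt.eventually_ne hne'] with w hw2 hne2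
    by_cases heq : w = w₀
    · subst heq
      rw [fibreValue, fibreValue, if_pos hw, if_pos hw, ← dslope_same, ← dslope_same,
        div_mul_cancel₀ _ hne2]
    · have h1 := sub_smul_dslope g w₀ w
      have h2 := sub_smul_dslope h w₀ w
      rw [hg0 hw, sub_zero, smul_eq_mul] at h1
      rw [hh0 hw, sub_zero, smul_eq_mul] at h2
      rw [fibreValue, fibreValue, if_neg (hw2 heq), if_neg (hw2 heq), ← h1, ← h2]
      field_simp
  · rw [fibreValue, if_neg hw] at hne
    refine ⟨fun w => g w / h w, hg.div hh hne, ?_⟩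
    filter_upwards [hlat, hh.continuousAt.eventually_ne hne] with w hw2 hne2
    have hw3 : w ∉ lattice τ := by
      by_cases heq : w = w₀
      · rwa [heq]
      · exact hw2 heq
    rw [fibreValue, fibreValue, if_neg hw3, if_neg hw3, div_mul_cancel₀ _ hne2]

theorem analyticAt_psum (I : Finset (Fin 3)) (x : Fin 3 → ℂ) : AnalyticAt ℂ (psum I) x :=
  Finset.analyticAt_fun_sum I fun i _ =>
    (ContinuousLinearMap.proj (R := ℂ) (φ := fun _ : Fin 3 => ℂ) i).analyticAt x

theorem analyticAt_cube {E : Type*} [NormedAddCommGroup E] [NormedSpace ℂ E]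
    {f : Finset (Fin 3) → E → ℂ} {x : E} (hf : ∀ I, AnalyticAt ℂ (f I) x) (h0 : ∀ I, f I x ≠ 0) :
    AnalyticAt ℂ (fun y => cube fun I => f I y) x := by
  unfold cube
  refine AnalyticAt.mul ((((hf _).mul (hf _)).mul (hf _)).mul (hf _)) (AnalyticAt.inv
    ((((hf _).mul (hf _)).mul (hf _)).mul (hf _)) ?_)
  simp [h0]

/-- On a fibre, the quotient of a section by the cube of `σ` is an entire function. -/
theorem TwistedClass.analyticAt_div_cubeSigma {U : Set ℍ} (s : TwistedClass U) (τ : U)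
    (x₀ : Fin 3 → ℂ) :
    AnalyticAt ℂ (fun x => s.toFun τ (proj τ.1 x) / cubeSigma τ.1 x) x₀ := by
  obtain ⟨g, F, hg, hF, hs⟩ := s.hol τ x₀
  have hs' : ∀ᶠ x in 𝓝 x₀, s.toFun τ (proj τ.1 x) =
      F τ.1 x * cube (fun I => fibreValue τ.1 (g I τ.1) (psum I x)) := by
    have hc : Tendsto (fun x : Fin 3 → ℂ => (τ.1, x)) (𝓝 x₀) (𝓝 (τ.1, x₀)) :=
      (Continuous.prodMk_right τ.1).tendsto x₀
    filter_upwards [hc.eventually hs] with x hx using hx τ.2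
  have hr : ∀ I, ∃ r : ℂ → ℂ, AnalyticAt ℂ r (psum I x₀) ∧ ∀ᶠ w in 𝓝 (psum I x₀),
      fibreValue τ.1 (g I τ.1) w = r w * fibreValue τ.1 (sigma τ.1) w := fun I =>
    exists_analyticAt_fibreValue_eq_mul (hg I).1.analyticAt_right (analyticAt_sigma _ _)
      (fun hw => ((hg I).2.1).self_of_nhds hw) (fun hw => (sigma_eq_zero_iff _ _).mpr hw)
      (fibreValue_sigma_ne_zero _ _)
  choose r hra hre using hr
  have hr0 : ∀ I, r I (psum I x₀) ≠ 0 := fun I h => by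
    have := (hre I).self_of_nhds
    rw [h, zero_mul] at this
    exact (hg I).2.2 this
  have hA : AnalyticAt ℂ (fun x => F τ.1 x * cube fun I => r I (psum I x)) x₀ :=
    hF.analyticAt_right.mul (analyticAt_cube (f := fun I x => r I (psum I x))
      (fun I => (hra I).fun_comp (analyticAt_psum I x₀)) hr0)
  refine hA.congr ?_
  have hall : ∀ᶠ x in 𝓝 x₀, ∀ I, fibreValue τ.1 (g I τ.1) (psum I x) =
      r I (psum I x) * fibreValue τ.1 (sigma τ.1) (psum I x) :=
    eventually_all.mpr fun I => (analyticAt_psum I x₀).continuousAt.eventually (hre I)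
  filter_upwards [hs', hall] with x h1 h2
  rw [h1]
  simp only [h2, cube_mul]
  rw [← mul_assoc]
  exact (mul_div_cancel_right₀ _ (cubeSigma_ne_zero τ.1 x)).symm

theorem fibreValue_id_ne_zero (τ : ℍ) (w : ℂ) : fibreValue τ (fun w => w) w ≠ 0 := by
  unfold fibreValue
  split_ifs with h
  · simp
  · intro h0
    replace h0 : w = 0 := h0
    exact h (h0 ▸ zero_mem _)

/-- The identity theorem applies fibre by fibre to the quotients by `cubeSigma`, so connectedness is
needed only for ℂ³. -/
theorem TwistedClass.eq_of_hasCompletion {U : Set ℍ} {s t : TwistedClass U}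
    {a b : EllBorel U} (hs : s.HasCompletion a) (ht : t.HasCompletion b)
    (hab : ∀ τ, a.at τ = b.at τ) : s = t := by
  have key : ∀ (τ : U) (x : Fin 3 → ℂ), s.toFun τ (proj τ.1 x) = t.toFun τ (proj τ.1 x) := by
    intro τ x
    have h1 : (fun x => s.toFun τ (proj τ.1 x) / cubeSigma τ.1 x) =
        fun x => t.toFun τ (proj τ.1 x) / cubeSigma τ.1 x := by
      refine AnalyticOnNhd.eq_of_eventuallyEq (𝕜 := ℂ) (z₀ := 0)
        (fun z _ => s.analyticAt_div_cubeSigma τ z)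
        (fun z _ => t.analyticAt_div_cubeSigma τ z) ?_
      filter_upwards [hs τ, ht τ] with x h1 h2
      rw [hab] at h1
      have h3 := h1.unique h2
      have h4 : (cube (fun I => fibreValue τ.1 (fun w => w) (psum I x)))⁻¹ ≠ 0 :=
        inv_ne_zero (cube_ne_zero fun I => fibreValue_id_ne_zero τ.1 _)
      rw [mul_right_cancel₀ h4 h3]
    have h2 := congrFun h1 x
    exact (div_left_inj' (cubeSigma_ne_zero τ.1 x)).mp h2
  cases s
  cases t
  congr
  funext τ p
  obtain ⟨x, rfl⟩ := proj_surjective τ.1 p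
  exact key τ x

/-! ### Entire functions with exponential factors of automorphy -/

theorem exists_reduce_lattice (τ : ℍ) (w : ℂ) : ∃ a b : ℤ, ∃ s ∈ Set.Icc (0 : ℝ) 1,
    ∃ t ∈ Set.Icc (0 : ℝ) 1, w = (s + t * τ : ℂ) + (a + b * τ) := by
  have him : (τ : ℂ).im ≠ 0 := τ.im_ne_zero
  set t : ℝ := w.im / (τ : ℂ).im with ht
  set s : ℝ := w.re - t * (τ : ℂ).re with hs
  refine ⟨⌊s⌋, ⌊t⌋, Int.fract s, ⟨Int.fract_nonneg s, (Int.fract_lt_one s).le⟩, Int.fract t,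
    ⟨Int.fract_nonneg t, (Int.fract_lt_one t).le⟩, ?_⟩
  have h1 : w = s + t * τ := by
    apply Complex.ext
    · simp [hs]
    · simp [ht]
      exact (div_mul_cancel₀ _ him).symm
  have h2 : (s : ℂ) = Int.fract s + ⌊s⌋ := by exact_mod_cast (Int.fract_add_floor s).symm
  have h3 : (t : ℂ) = Int.fract t + ⌊t⌋ := by exact_mod_cast (Int.fract_add_floor t).symm
  conv_lhs => rw [h1, h2, h3]
  ring

/-- An entire function with two independent periods is constant. -/
theorem eq_const_of_periodic {τ : ℍ} {f : ℂ → ℂ} (hf : Differentiable ℂ f)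
    (hp : ∀ (a b : ℤ) (w : ℂ), f (w + (a + b * τ)) = f w) (w : ℂ) : f w = f 0 := by
  refine hf.apply_eq_apply_of_bounded ?_ w 0
  have hK : IsCompact ((fun p : ℝ × ℝ => f (p.1 + p.2 * τ)) ''
      (Set.Icc (0 : ℝ) 1 ×ˢ Set.Icc (0 : ℝ) 1)) := by
    refine (isCompact_Icc.prod isCompact_Icc).image ?_
    have := hf.continuous
    fun_prop
  refine hK.isBounded.subset ?_
  rintro _ ⟨w, rfl⟩
  obtain ⟨a, b, s, hs, t, ht, rfl⟩ := exists_reduce_lattice τ w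
  exact ⟨(s, t), ⟨hs, ht⟩, (hp a b _).symm⟩

/-- A nowhere vanishing entire function whose factors of automorphy are exponentials of affine
functions is the exponential of a quadratic polynomial. -/
theorem exists_eq_exp_quadratic {τ : ℍ} {h : ℂ → ℂ} (hd : Differentiable ℂ h)
    (h0 : ∀ w, h w ≠ 0)
    (hp : ∀ a b : ℤ, ∃ α β : ℂ, ∀ w, h (w + (a + b * τ)) = Complex.exp (α + β * w) * h w) :
    ∃ A B C : ℂ, ∀ w, h w = Complex.exp (A + B * w + C * w ^ 2) := by
  have hd' : Differentiable ℂ (deriv h) := hd.deriv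
  -- A translation changes the logarithmic derivative by a constant, so its derivative is doubly
  -- periodic and entire, hence constant by Liouville; thus `L` is affine.
  set L : ℂ → ℂ := fun w => deriv h w / h w with hL
  have hLd : Differentiable ℂ L := hd'.div hd h0
  have hLp : ∀ a b : ℤ, ∃ β : ℂ, ∀ w, L (w + (a + b * τ)) = β + L w := by
    intro a b
    obtain ⟨α, β, hαβ⟩ := hp a b
    refine ⟨β, fun w => ?_⟩
    have h1 : deriv h (w + (a + b * τ)) = β * (Complex.exp (α + β * w) * h w) +
        Complex.exp (α + β * w) * deriv h w := by
      rw [← deriv_comp_add_const, funext hαβ]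
      have e1 : HasDerivAt (fun w => Complex.exp (α + β * w)) (Complex.exp (α + β * w) * β) w := by
        have := (((hasDerivAt_id w).const_mul β).const_add α).cexp
        simpa using this
      rw [(e1.fun_mul (hd w).hasDerivAt).deriv]
      ring
    have h2 := h0 w
    have h3 := Complex.exp_ne_zero (α + β * w)
    simp only [hL, h1, hαβ]
    field_simp
  have hc := eq_const_of_periodic (τ := τ) hLd.deriv fun a b w => by
    obtain ⟨β, hβ⟩ := hLp a b
    rw [← deriv_comp_add_const, funext hβ, deriv_const_add']
  set C := deriv L 0 / 2 with hC
  set B := L 0 with hB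
  have hLeq : ∀ w, L w = B + 2 * C * w := by
    intro w
    have hder : ∀ w, HasDerivAt (fun w => L w - 2 * C * w) 0 w := fun w => by
      have e1 := (hLd w).hasDerivAt.sub ((hasDerivAt_id w).const_mul (2 * C))
      rw [hc w] at e1
      convert! e1 using 1
      rw [hC]; ring
    have := is_const_of_deriv_eq_zero (fun w => (hder w).differentiableAt)
      (fun w => (hder w).deriv) w 0
    simp only [mul_zero, sub_zero] at this
    linear_combination this
  refine ⟨Complex.log (h 0), B, C, fun w => ?_⟩
  have hder : ∀ w, HasDerivAt (fun w => h w * Complex.exp (-(B * w + C * w ^ 2))) 0 w := fun w => by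
    have e1 : HasDerivAt (fun w => Complex.exp (-(B * w + C * w ^ 2)))
        (Complex.exp (-(B * w + C * w ^ 2)) * -(B + C * (2 * w))) w := by
      have := ((((hasDerivAt_id w).const_mul B).add
        ((hasDerivAt_pow 2 w).const_mul C)).neg).cexp
      simpa using this
    convert! (hd w).hasDerivAt.mul e1 using 1
    have h2 : deriv h w = (B + 2 * C * w) * h w := by
      rw [← hLeq w, hL]; field_simp [h0 w]
    rw [h2]
    ring
  have := is_const_of_deriv_eq_zero (fun w => (hder w).differentiableAt)
    (fun w => (hder w).deriv) w 0
  simp only [mul_zero, add_zero, ne_eq, OfNat.ofNat_ne_zero, not_false_eq_true, zero_pow, neg_zero,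
    Complex.exp_zero, mul_one] at this
  rw [add_assoc, Complex.exp_add, Complex.exp_log (h0 0), ← this, mul_assoc, ← Complex.exp_add,
    neg_add_cancel, Complex.exp_zero, mul_one]

/-! ### Modular invariance -/

section Modular

variable (γ : Matrix.SpecialLinearGroup (Fin 2) ℤ) (τ : ℍ)

/-- The factor `cτ + d`. -/
def autFactor : ℂ := ((γ 1 0 : ℤ) : ℂ) * (τ : ℂ) + ((γ 1 1 : ℤ) : ℂ)

theorem det_eq_one : (γ 0 0 : ℂ) * γ 1 1 - γ 0 1 * γ 1 0 = 1 := by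
  have := γ.det_coe
  rw [Matrix.det_fin_two] at this
  exact_mod_cast this

theorem autFactor_ne_zero : autFactor γ τ ≠ 0 := by
  have := UpperHalfPlane.denom_ne_zero (γ : GL (Fin 2) ℝ) τ
  simpa [UpperHalfPlane.denom, autFactor] using this

theorem coe_smul_eq : ((γ • τ : ℍ) : ℂ) = (γ 0 0 * τ + γ 0 1) / autFactor γ τ := by
  rw [UpperHalfPlane.coe_specialLinearGroup_apply]
  simp [autFactor]

theorem exists_div_autFactor (a b : ℤ) : ∃ a' b' : ℤ,
    (a + b * τ : ℂ) / autFactor γ τ = a' + b' * (γ • τ : ℍ) := by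
  -- These solve a + bτ = a'(cτ + d) + b'(γ₀₀τ + γ₀₁), using determinant one.
  refine ⟨γ 0 0 * a - γ 0 1 * b, γ 1 1 * b - γ 1 0 * a, ?_⟩
  have hj := autFactor_ne_zero γ τ
  rw [coe_smul_eq, div_eq_iff hj, add_mul, mul_assoc, div_mul_cancel₀ _ hj, autFactor]
  push_cast
  linear_combination (-(a : ℂ) - b * τ) * det_eq_one γ

theorem div_autFactor_mem_iff (w : ℂ) :
    w / autFactor γ τ ∈ lattice (γ • τ) ↔ w ∈ lattice τ := by
  have hj := autFactor_ne_zero γ τ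
  rw [mem_lattice_iff, mem_lattice_iff]
  constructor
  · rintro ⟨a, b, h⟩
    refine ⟨a * γ 1 1 + b * γ 0 1, a * γ 1 0 + b * γ 0 0, ?_⟩
    rw [coe_smul_eq, div_eq_iff hj, add_mul, mul_assoc, div_mul_cancel₀ _ hj, autFactor] at h
    rw [h]
    push_cast
    ring
  · rintro ⟨a, b, rfl⟩
    exact exists_div_autFactor γ τ a b

/-- By the chain rule, the factor (cτ + d)⁻¹ at lattice points is the derivative of the rescaling w
↦ w / (cτ + d). -/
theorem pullbackFactor_mul (w : ℂ) :
    pullbackFactor γ τ w * fibreValue (γ • τ) (sigma (γ • τ)) (w / autFactor γ τ) =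
      fibreValue τ (fun z => sigma (γ • τ) (z / autFactor γ τ)) w := by
  have hmem := div_autFactor_mem_iff γ τ w
  by_cases hw : w ∈ lattice τ
  · rw [pullbackFactor, fibreValue, fibreValue, if_pos hw, if_pos (hmem.mpr hw), if_pos hw]
    have h1 := ((differentiable_sigma (γ • τ) (w / autFactor γ τ)).hasDerivAt.comp w
      ((hasDerivAt_id w).div_const (autFactor γ τ))).deriv
    rw [show (fun z => sigma (γ • τ) (z / autFactor γ τ)) =
      sigma (γ • τ) ∘ fun z => id z / autFactor γ τ from rfl, h1, autFactor]
    ring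
  · rw [pullbackFactor, fibreValue, fibreValue, if_neg hw, if_neg (mt hmem.mp hw), if_neg hw,
      one_mul]

theorem pullbackFactor_ne_zero (w : ℂ) : pullbackFactor γ τ w ≠ 0 := by
  unfold pullbackFactor
  split_ifs
  · exact inv_ne_zero (autFactor_ne_zero γ τ)
  · exact one_ne_zero

theorem pullbackFactor_add (a b : ℤ) (w : ℂ) :
    pullbackFactor γ τ (w + (a + b * τ)) = pullbackFactor γ τ w := by
  have h2 := add_lattice_mem_iff (τ := τ) a b (w := w)
  unfold pullbackFactor
  by_cases hw : w ∈ lattice τ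
  · rw [if_pos (h2.mpr hw), if_pos hw]
  · rw [if_neg (mt h2.mp hw), if_neg hw]

/-- Up to the exponential of a quadratic polynomial, `σ` is a modular section of `O(-0)`. -/
theorem exists_pullback_sigma_eq : ∃ A B C : ℂ, ∀ w,
    pullbackFactor γ τ w * fibreValue (γ • τ) (sigma (γ • τ)) (w / autFactor γ τ) =
      Complex.exp (A + B * w + C * w ^ 2) * fibreValue τ (sigma τ) w := by
  set f : ℂ → ℂ := fun z => sigma (γ • τ) (z / autFactor γ τ) with hf
  have hfan : ∀ w, AnalyticAt ℂ f w := fun w =>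
    (analyticAt_sigma (γ • τ) _).fun_comp (analyticAt_id.div_const)
  set h : ℂ → ℂ := fun w => pullbackFactor γ τ w *
    fibreValue (γ • τ) (sigma (γ • τ)) (w / autFactor γ τ) / fibreValue τ (sigma τ) w with hh
  have hd : Differentiable ℂ h := fun w₀ => by
    obtain ⟨r, hr, hre⟩ := exists_analyticAt_fibreValue_eq_mul (τ := τ) (hfan w₀)
      (analyticAt_sigma τ w₀)
      (fun hw => (sigma_eq_zero_iff _ _).mpr ((div_autFactor_mem_iff γ τ w₀).mpr hw))
      (fun hw => (sigma_eq_zero_iff _ _).mpr hw) (fibreValue_sigma_ne_zero τ w₀)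
    refine (hr.congr ?_).differentiableAt
    filter_upwards [hre] with w hw
    rw [hh]
    simp only
    rw [pullbackFactor_mul, hw, mul_div_cancel_right₀ _ (fibreValue_sigma_ne_zero τ w)]
  have h0 : ∀ w, h w ≠ 0 := fun w => div_ne_zero
    (mul_ne_zero (pullbackFactor_ne_zero γ τ w) (fibreValue_sigma_ne_zero _ _))
    (fibreValue_sigma_ne_zero τ w)
  obtain ⟨A, B, C, hABC⟩ := exists_eq_exp_quadratic (τ := τ) hd h0 fun a b => by
    obtain ⟨a', b', hab⟩ := exists_div_autFactor γ τ a b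
    -- Both automorphy exponents are affine in w; these are the constant term and the slope of their
    -- difference.
    refine ⟨autExp (γ • τ) a' b' 0 - autExp τ a b 0,
      -2 * Real.pi * Complex.I * (b' / autFactor γ τ - b), fun w => ?_⟩
    simp only [hh]
    rw [add_div, hab, fibreValue_sigma_add_lattice, fibreValue_sigma_add_lattice,
      pullbackFactor_add]
    have h1 : autExp (γ • τ) a' b' (w / autFactor γ τ) = (autExp (γ • τ) a' b' 0 -
        autExp τ a b 0 + -2 * Real.pi * Complex.I * (b' / autFactor γ τ - b) * w) +
        autExp τ a b w := by
      unfold autExp; ring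
    rw [h1, Complex.exp_add]
    have h2 := fibreValue_sigma_ne_zero τ w
    have h3 := Complex.exp_ne_zero (autExp τ a b w)
    field_simp
  refine ⟨A, B, C, fun w => ?_⟩
  rw [← hABC w, hh]
  exact (div_mul_cancel₀ _ (fibreValue_sigma_ne_zero τ w)).symm

theorem cubeSigma_smul (x : Fin 3 → ℂ) :
    cube (fun I => pullbackFactor γ τ (psum I x)) *
      cubeSigma (γ • τ) (fun i => x i / autFactor γ τ) = cubeSigma τ x := by
  obtain ⟨A, B, C, h⟩ := exists_pullback_sigma_eq γ τ
  have hp : ∀ I, psum I (fun i => x i / autFactor γ τ) = psum I x / autFactor γ τ := fun I => by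
    simp only [psum, Finset.sum_div]
  simp only [cubeSigma, hp, ← cube_mul, h]
  rw [cube_mul, cube_exp_quadratic, one_mul]

end Modular

theorem sigmaClass_descends : (sigmaClass Set.univ).Descends := fun γ τ x => by
  refine Eq.trans ?_ ((cubeSigma_smul γ τ x).trans
    (sigmaClass_apply (⟨τ, Set.mem_univ _⟩ : (Set.univ : Set ℍ)) x).symm)
  congr 1
  exact sigmaClass_apply (⟨γ • τ, Set.mem_univ _⟩ : (Set.univ : Set ℍ)) _

/-! ### Convergent power series -/

theorem hasSum_mul_antidiagonal {A : Type*} [AddCommMonoid A] [Finset.HasAntidiagonal A]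
    {f g : A → ℂ} {v w : ℂ} (hf : HasSum f v) (hg : HasSum g w) :
    HasSum (fun n => ∑ kl ∈ Finset.HasAntidiagonal.antidiagonal n, f kl.1 * g kl.2) (v * w) := by
  have hab := summable_mul_of_summable_norm hf.summable.norm hg.summable.norm
  have h1 := Summable.tsum_mul_tsum_eq_tsum_sum_antidiagonal hf.summable hg.summable hab
  have h3 := (summable_sum_mul_antidiagonal_of_summable_mul hab).hasSum
  rwa [← h1, hf.tsum_eq, hg.tsum_eq] at h3

theorem hasSum_mul_eval {a b : MvPowerSeries (Fin 3) ℂ} {x : Fin 3 → ℂ} {v w : ℂ}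
    (ha : HasSum (fun n : Fin 3 →₀ ℕ => MvPowerSeries.coeff n a * n.prod fun i k => x i ^ k) v)
    (hb : HasSum (fun n : Fin 3 →₀ ℕ => MvPowerSeries.coeff n b * n.prod fun i k => x i ^ k) w) :
    HasSum (fun n : Fin 3 →₀ ℕ => MvPowerSeries.coeff n (a * b) * n.prod fun i k => x i ^ k)
      (v * w) := by
  refine (hasSum_mul_antidiagonal ha hb).congr_fun fun n => ?_
  rw [MvPowerSeries.coeff_mul, Finset.sum_mul]
  refine Finset.sum_congr rfl fun p hp => ?_
  rw [← Finset.HasAntidiagonal.mem_antidiagonal.mp hp, Finsupp.prod_add_index' (by simp)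
    (fun i k l => pow_add (x i) k l)]
  ring

theorem IsTaylorExpansion.mul {F G : (Fin 3 → ℂ) → ℂ} {a b : MvPowerSeries (Fin 3) ℂ}
    (ha : IsTaylorExpansion F a) (hb : IsTaylorExpansion G b) :
    IsTaylorExpansion (fun x => F x * G x) (a * b) := by
  filter_upwards [ha, hb] with x h1 h2 using hasSum_mul_eval h1 h2

theorem hasSum_one_eval (x : Fin 3 → ℂ) :
    HasSum (fun n : Fin 3 →₀ ℕ => MvPowerSeries.coeff n (1 : MvPowerSeries (Fin 3) ℂ) *
      n.prod fun i k => x i ^ k) 1 := by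
  convert hasSum_single (0 : Fin 3 →₀ ℕ) ?_ using 1
  · simp
  · intro n hn
    simp [MvPowerSeries.coeff_one, hn]

theorem hasSum_pow_eval {a : MvPowerSeries (Fin 3) ℂ} {x : Fin 3 → ℂ} {v : ℂ}
    (ha : HasSum (fun n : Fin 3 →₀ ℕ => MvPowerSeries.coeff n a * n.prod fun i k => x i ^ k) v)
    (d : ℕ) :
    HasSum (fun n : Fin 3 →₀ ℕ => MvPowerSeries.coeff n (a ^ d) * n.prod fun i k => x i ^ k)
      (v ^ d) := by
  induction d with
  | zero => simpa using hasSum_one_eval x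
  | succ d ih => simpa [pow_succ] using hasSum_mul_eval ih ha

/-- The partial sum of the variables over `I`. -/
def sumX (R : Type*) [CommSemiring R] (I : Finset (Fin 3)) : MvPowerSeries (Fin 3) R :=
  ∑ i ∈ I, MvPowerSeries.X i

theorem map_sumX {R S : Type*} [CommSemiring R] [CommSemiring S] (f : R →+* S)
    (I : Finset (Fin 3)) : (sumX R I).map f = sumX S I := by
  simp [sumX]

theorem hasSubst_sumX {R : Type*} [CommRing R] (I : Finset (Fin 3)) :
    PowerSeries.HasSubst (sumX R I) :=
  PowerSeries.HasSubst.of_constantCoeff_zero (by simp [sumX])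

theorem hasSum_sumX_eval (I : Finset (Fin 3)) (x : Fin 3 → ℂ) :
    HasSum (fun n : Fin 3 →₀ ℕ => MvPowerSeries.coeff n (sumX ℂ I) *
      n.prod fun i k => x i ^ k) (psum I x) := by
  simp only [sumX, map_sum, Finset.sum_mul, psum]
  refine hasSum_sum fun i _ => ?_
  convert hasSum_single (Finsupp.single i 1) ?_ using 1
  · simp [MvPowerSeries.coeff_X]
  · intro n hn
    simp [MvPowerSeries.coeff_X, hn]

/-- The coefficients of a power of a sum of variables are natural numbers, so taking norms termwise
amounts to evaluating the same expansion at the norms of the coordinates. -/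
theorem hasSum_norm_sumX_pow_eval (I : Finset (Fin 3)) (x : Fin 3 → ℂ) (d : ℕ) :
    HasSum (fun n : Fin 3 →₀ ℕ => ‖MvPowerSeries.coeff n (sumX ℂ I ^ d) *
      n.prod fun i k => x i ^ k‖) ((∑ i ∈ I, ‖x i‖) ^ d) := by
  have h := hasSum_pow_eval (hasSum_sumX_eval I fun i => (‖x i‖ : ℂ)) d
  rw [← Complex.hasSum_ofReal]
  convert h using 1
  · funext n
    have h1 : MvPowerSeries.coeff n (sumX ℂ I ^ d) =
        ((MvPowerSeries.coeff n (sumX ℕ I ^ d) : ℕ) : ℂ) := by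
      rw [← map_sumX (Nat.castRingHom ℂ), ← map_pow, MvPowerSeries.coeff_map]
      simp
    rw [h1, norm_mul, Complex.norm_natCast, Finsupp.prod, Finsupp.prod, norm_prod]
    push_cast
    simp
  · simp [psum]

/-- Fubini for an absolutely summable double series; it exchanges summation over the degree d with
summation over monomials. -/
theorem hasSum_of_fiberwise {α β : Type*} {F : α × β → ℂ} {g : α → ℂ} {k : β → ℂ} {N : α → ℝ}
    {v : ℂ} (hN : ∀ d, HasSum (fun n => ‖F (d, n)‖) (N d)) (hNs : Summable N)
    (hg : ∀ d, HasSum (fun n => F (d, n)) (g d)) (hv : HasSum g v)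
    (hk : ∀ n, HasSum (fun d => F (d, n)) (k n)) : HasSum k v := by
  have hFs : Summable F := by
    refine Summable.of_norm ((summable_prod_of_nonneg fun _ => norm_nonneg _).mpr
      ⟨fun d => (hN d).summable, ?_⟩)
    exact hNs.congr fun d => (hN d).tsum_eq.symm
  have htot : HasSum F v := by
    have := hFs.hasSum
    rwa [(this.prod_fiberwise hg).unique hv] at this
  have hswap : HasSum (fun q : β × α => F (q.2, q.1)) v :=
    (Equiv.prodComm _ _).hasSum_iff.mpr htot
  exact hswap.prod_fiberwise hk

/-- Substitution of a partial sum of the variables into a convergent power series. -/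
theorem hasSum_subst_eval (p : PowerSeries ℂ) (I : Finset (Fin 3)) (x : Fin 3 → ℂ) (v : ℂ)
    (hρ : Summable fun d => ‖PowerSeries.coeff d p‖ * (∑ i ∈ I, ‖x i‖) ^ d)
    (hv : HasSum (fun d => PowerSeries.coeff d p * psum I x ^ d) v) :
    HasSum (fun n : Fin 3 →₀ ℕ => MvPowerSeries.coeff n (p.subst (sumX ℂ I)) *
      n.prod fun i k => x i ^ k) v := by
  refine hasSum_of_fiberwise (F := fun q : ℕ × (Fin 3 →₀ ℕ) => PowerSeries.coeff q.1 p *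
    (MvPowerSeries.coeff q.2 (sumX ℂ I ^ q.1) * q.2.prod fun i k => x i ^ k)) (fun d => ?_) hρ
    (fun d => ?_) hv fun n => ?_
  · have h0 := hasSum_norm_sumX_pow_eval I x d
    have h := HasSum.mul_left ‖PowerSeries.coeff d p‖ h0
    refine h.congr_fun fun n => ?_
    exact norm_mul _ _
  · have h0 := hasSum_pow_eval (hasSum_sumX_eval I x) d
    exact HasSum.mul_left (PowerSeries.coeff d p) h0
  · have hfin := PowerSeries.coeff_subst_finite (hasSubst_sumX (R := ℂ) I) p n
    have h1 := (summable_of_hasFiniteSupport (L := .unconditional ℕ) hfin).hasSum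
    rw [tsum_eq_finsum hfin, ← PowerSeries.coeff_subst (hasSubst_sumX I)] at h1
    refine (h1.mul_right (n.prod fun i k => x i ^ k)).congr_fun fun d => ?_
    rw [smul_eq_mul, mul_assoc]

theorem isTaylorExpansion_subst {f : ℂ → ℂ} {p : PowerSeries ℂ}
    (h : ∀ᶠ w in 𝓝 (0 : ℂ), HasSum (fun d => PowerSeries.coeff d p * w ^ d) (f w))
    (I : Finset (Fin 3)) :
    IsTaylorExpansion (fun x => f (psum I x)) (p.subst (sumX ℂ I)) := by
  -- Convergence is also used at the real point ∑ ‖xᵢ‖, where it supplies the absolutely convergent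
  -- majorant.
  have h1 : Tendsto (fun x : Fin 3 → ℂ => ((∑ i ∈ I, ‖x i‖ : ℝ) : ℂ)) (𝓝 0) (𝓝 0) := by
    have : Continuous fun x : Fin 3 → ℂ => ((∑ i ∈ I, ‖x i‖ : ℝ) : ℂ) := by fun_prop
    simpa using this.tendsto 0
  have h2 : Tendsto (psum I) (𝓝 0) (𝓝 0) := by
    have := (analyticAt_psum I 0).continuousAt.tendsto
    simpa [psum] using this
  filter_upwards [h1.eventually h, h2.eventually h] with x hx1 hx2
  refine hasSum_subst_eval p I x _ ?_ hx2
  convert hx1.summable.norm using 2 with d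
  rw [norm_mul, norm_pow, Complex.norm_real, Real.norm_of_nonneg]
  exact Finset.sum_nonneg fun _ _ => norm_nonneg _

theorem powerSeries_eq_of_hasSum {f : ℂ → ℂ} {p r : PowerSeries ℂ}
    (hp : ∀ᶠ w in 𝓝 (0 : ℂ), HasSum (fun d => PowerSeries.coeff d p * w ^ d) (f w))
    (hr : ∀ᶠ w in 𝓝 (0 : ℂ), HasSum (fun d => PowerSeries.coeff d r * w ^ d) (f w)) : p = r := by
  have key : ∀ s : PowerSeries ℂ,
      (∀ᶠ w in 𝓝 (0 : ℂ), HasSum (fun d => PowerSeries.coeff d s * w ^ d) (f w)) →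
      HasFPowerSeriesAt f
        (FormalMultilinearSeries.ofScalars ℂ fun n => PowerSeries.coeff n s) 0 := fun s hs => by
    rw [hasFPowerSeriesAt_iff]
    filter_upwards [hs] with w hw
    simpa [FormalMultilinearSeries.coeff_ofScalars, mul_comm] using hw
  have h := (key p hp).eq_formalMultilinearSeries (key r hr)
  ext n
  have := congrArg (fun q => FormalMultilinearSeries.coeff q n) h
  simpa [FormalMultilinearSeries.coeff_ofScalars] using this

theorem hasSum_powerSeries_mul {p r : PowerSeries ℂ} {w u v : ℂ}
    (hp : HasSum (fun d => PowerSeries.coeff d p * w ^ d) u)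
    (hr : HasSum (fun d => PowerSeries.coeff d r * w ^ d) v) :
    HasSum (fun d => PowerSeries.coeff d (p * r) * w ^ d) (u * v) := by
  refine (hasSum_mul_antidiagonal hp hr).congr_fun fun n => ?_
  rw [PowerSeries.coeff_mul, Finset.sum_mul]
  refine Finset.sum_congr rfl fun q hq => ?_
  rw [← Finset.HasAntidiagonal.mem_antidiagonal.mp hq]
  ring

/-! ### The Taylor expansion of `σ(w) / w` and of its cube -/

/-- The entire function `σ(w) / w`. -/
def sigmaDiv (τ : ℍ) : ℂ → ℂ := dslope (sigma τ) 0

theorem hasSum_sigmaSeries (τ : ℍ) (w : ℂ) :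
    HasSum (fun d => PowerSeries.coeff d (sigmaSeries τ) * w ^ d) (sigmaDiv τ w) := by
  simp only [sigmaSeries, PowerSeries.coeff_mk]
  by_cases hw : w = 0
  · subst hw
    convert hasSum_single 0 ?_ using 1
    · simp [sigmaDiv]
    · intro n hn
      simp [hn]
  · have h := Complex.hasSum_taylorSeries_of_entire (differentiable_sigma τ) 0 w
    rw [← hasSum_nat_add_iff' 1] at h
    have h2 := h.mul_left w⁻¹
    have h3 : w⁻¹ * (sigma τ w - ∑ i ∈ Finset.range 1, ((i.factorial : ℂ)⁻¹ •
        (w - 0) ^ i • iteratedDeriv i (sigma τ) 0)) = sigmaDiv τ w := by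
      simp [sigma_zero, sigmaDiv, dslope_of_ne _ hw, slope_def_field, div_eq_inv_mul]
    rw [h3] at h2
    convert! h2 using 2 with d
    simp only [smul_eq_mul, sub_zero]
    field_simp
    ring

theorem sigmaDiv_zero (τ : ℍ) : sigmaDiv τ 0 = 2 * Real.pi * Complex.I := by
  rw [sigmaDiv, dslope_same, deriv_sigma_zero]

theorem sigmaDiv_zero_ne_zero (τ : ℍ) : sigmaDiv τ 0 ≠ 0 := by
  simp [sigmaDiv_zero, Real.pi_ne_zero, Complex.I_ne_zero]

theorem analyticAt_sigmaDiv (τ : ℍ) : AnalyticAt ℂ (sigmaDiv τ) 0 := by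
  obtain ⟨p, hp⟩ := analyticAt_sigma τ 0
  exact ⟨_, hp.has_fpower_series_dslope_fslope⟩

/-- The Taylor series of the analytic reciprocal is the formal inverse, by uniqueness of expansions;
so the denominators of the cube converge too. -/
theorem exists_inverse_sigmaSeries (τ : ℍ) : ∃ u : PowerSeries ℂ, sigmaSeries τ * u = 1 ∧
    ∀ᶠ w in 𝓝 (0 : ℂ), HasSum (fun d => PowerSeries.coeff d u * w ^ d) (sigmaDiv τ w)⁻¹ := by
  obtain ⟨q, hq⟩ := (analyticAt_sigmaDiv τ).inv (sigmaDiv_zero_ne_zero τ)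
  have hu : ∀ᶠ w in 𝓝 (0 : ℂ), HasSum (fun d => PowerSeries.coeff d (PowerSeries.mk q.coeff) *
      w ^ d) (sigmaDiv τ w)⁻¹ := by
    filter_upwards [hasFPowerSeriesAt_iff.mp hq] with w hw
    simpa [mul_comm] using hw
  refine ⟨PowerSeries.mk q.coeff, ?_, hu⟩
  refine powerSeries_eq_of_hasSum (f := fun _ => 1) ?_ (Eventually.of_forall fun w => ?_)
  · filter_upwards [hu, (analyticAt_sigmaDiv τ).continuousAt.eventually_ne
      (sigmaDiv_zero_ne_zero τ)] with w hw hne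
    have := hasSum_powerSeries_mul (hasSum_sigmaSeries τ w) hw
    rwa [mul_inv_cancel₀ hne] at this
  · convert hasSum_single 0 ?_ using 1
    · simp
    · intro n hn
      simp [PowerSeries.coeff_one, hn]

/-- The cube of a series with given inverse. -/
def cubeOfInv {R : Type*} [CommRing R] (p u : PowerSeries R) : MvPowerSeries (Fin 3) R :=
  (p.subst (sumX R {0, 1, 2}) * p.subst (sumX R {0}) * p.subst (sumX R {1}) *
    p.subst (sumX R {2})) *
  (u.subst (sumX R {0, 1}) * u.subst (sumX R {0, 2}) * u.subst (sumX R {1, 2}) *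
    u.subst (sumX R ∅))

theorem cubicalSeries_eq {τ : ℍ} {u : PowerSeries ℂ} (hu : sigmaSeries τ * u = 1) :
    cubicalSeries τ = cubeOfInv (sigmaSeries τ) u := by
  have h1 : ∀ I, (sigmaSeries τ).subst (sumX ℂ I) * u.subst (sumX ℂ I) = 1 := fun I => by
    rw [← PowerSeries.subst_mul (hasSubst_sumX I), hu, ← PowerSeries.coe_substAlgHom
      (hasSubst_sumX I), map_one]
  have h2 : ∀ D E : MvPowerSeries (Fin 3) ℂ, D * E = 1 → D⁻¹ = E := fun D E h => by
    have h3 : MvPowerSeries.constantCoeff D ≠ 0 := fun h0 => by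
      have := congrArg MvPowerSeries.constantCoeff h
      rw [map_mul, h0, zero_mul, map_one] at this
      exact zero_ne_one this
    exact ((MvPowerSeries.eq_inv_iff_mul_eq_one h3).mpr (by rw [mul_comm]; exact h)).symm
  have h4 : ∀ I, ((sigmaSeries τ).subst (∑ i ∈ I, (MvPowerSeries.X i : MvPowerSeries (Fin 3) ℂ)) :
    MvPowerSeries (Fin 3) ℂ) = (sigmaSeries τ).subst (sumX ℂ I) := fun I => rfl
  rw [cubicalSeries, cubeOfInv, cube]
  simp only [h4]
  congr 1
  refine h2 _ _ ?_
  calc _ = ((sigmaSeries τ).subst (sumX ℂ {0, 1}) * u.subst (sumX ℂ {0, 1})) *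
        ((sigmaSeries τ).subst (sumX ℂ {0, 2}) * u.subst (sumX ℂ {0, 2})) *
        ((sigmaSeries τ).subst (sumX ℂ {1, 2}) * u.subst (sumX ℂ {1, 2})) *
        ((sigmaSeries τ).subst (sumX ℂ ∅) * u.subst (sumX ℂ ∅)) := by ring
    _ = 1 := by simp only [h1, mul_one]

theorem isTaylorExpansion_cubicalSeries (τ : ℍ) :
    IsTaylorExpansion (fun x => cube fun I => sigmaDiv τ (psum I x)) (cubicalSeries τ) := by
  obtain ⟨u, hu, hsum⟩ := exists_inverse_sigmaSeries τ
  have hp := isTaylorExpansion_subst (Eventually.of_forall (hasSum_sigmaSeries τ))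
  have hq := isTaylorExpansion_subst hsum
  have := (((hp {0, 1, 2}).mul (hp {0})).mul (hp {1})).mul (hp {2}) |>.mul
    ((((hq {0, 1}).mul (hq {0, 2})).mul (hq {1, 2})).mul (hq ∅))
  rw [cubicalSeries_eq hu, cubeOfInv]
  simpa only [cube, mul_inv] using this

theorem fibreValue_sigma_eq_near_zero (τ : ℍ) : ∀ᶠ w in 𝓝 (0 : ℂ),
    fibreValue τ (sigma τ) w = sigmaDiv τ w * fibreValue τ (fun w => w) w := by
  filter_upwards [eventually_nhdsWithin_iff.mp (eventually_notMem_lattice τ 0)] with w hw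
  by_cases h0 : w = 0
  · subst h0
    simp [fibreValue, sigmaDiv, zero_mem]
  · rw [fibreValue, fibreValue, if_neg (hw h0), if_neg (hw h0), sigmaDiv, dslope_of_ne _ h0,
      slope_def_field, sigma_zero, sub_zero, sub_zero, div_mul_cancel₀ _ h0]

theorem sigmaClass_hasCompletion {U : Set ℍ} {a : EllBorel U} (ha : IsCubicalClass a) :
    (sigmaClass U).HasCompletion a := by
  intro τ
  rw [ha τ]
  have hall : ∀ᶠ x in 𝓝 (0 : Fin 3 → ℂ), ∀ I, fibreValue τ.1 (sigma τ.1) (psum I x) =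
      sigmaDiv τ.1 (psum I x) * fibreValue τ.1 (fun w => w) (psum I x) :=
    eventually_all.mpr fun I => by
      have := (analyticAt_psum I 0).continuousAt.tendsto
      rw [show psum I 0 = 0 by simp [psum]] at this
      exact this.eventually (fibreValue_sigma_eq_near_zero τ.1)
  filter_upwards [isTaylorExpansion_cubicalSeries τ.1, hall] with x hx h
  convert hx using 1
  rw [sigmaClass_apply, cubeSigma]
  simp only [h, cube_mul]
  exact mul_inv_cancel_right₀ (cube_ne_zero fun I => fibreValue_id_ne_zero τ.1 _) _

/-! ### The coefficients of the cubical class -/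

theorem analyticAt_deriv_snd {G : ℂ × ℂ → ℂ} {p₀ : ℂ × ℂ} (hG : AnalyticAt ℂ G p₀) :
    AnalyticAt ℂ (fun p => deriv (fun z => G (p.1, z)) p.2) p₀ := by
  have h1 : AnalyticAt ℂ (fun p => fderiv ℂ G p (0, 1)) p₀ :=
    ((ContinuousLinearMap.apply ℂ ℂ ((0, 1) : ℂ × ℂ)).analyticAt _).fun_comp hG.fderiv
  refine h1.congr ?_
  filter_upwards [hG.eventually_analyticAt] with p hp
  have h2 : HasDerivAt (fun z : ℂ => (p.1, z)) ((0, 1) : ℂ × ℂ) p.2 :=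
    (hasDerivAt_const _ _).prodMk (hasDerivAt_id _)
  exact (HasFDerivAt.comp_hasDerivAt p.2 hp.differentiableAt.hasFDerivAt h2).deriv.symm

theorem analyticAt_iteratedDeriv_snd {G : ℂ × ℂ → ℂ} {p₀ : ℂ × ℂ} (hG : AnalyticAt ℂ G p₀)
    (m : ℕ) : AnalyticAt ℂ (fun p => iteratedDeriv m (fun z => G (p.1, z)) p.2) p₀ := by
  induction m with
  | zero => simpa using hG
  | succ m ih =>
    simp only [iteratedDeriv_succ]
    exact analyticAt_deriv_snd ih

theorem analyticAt_coeff_sigmaSeries (τ : ℍ) (n : ℕ) :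
    AnalyticAt ℂ (fun w : ℂ => PowerSeries.coeff n (sigmaSeries (UpperHalfPlane.ofComplex w)))
      (τ : ℂ) := by
  simp only [sigmaSeries, PowerSeries.coeff_mk]
  refine AnalyticAt.div_const ?_
  have h1 := analyticAt_iteratedDeriv_snd (holAt_sigma τ 0) (n + 1)
  have h2 : AnalyticAt ℂ (fun w : ℂ => (w, (0 : ℂ))) (τ : ℂ) := analyticAt_id.prod analyticAt_const
  exact AnalyticAt.fun_comp (f := fun w : ℂ => (w, (0 : ℂ))) h1 h2

/-! ### Growth along geodesic rays -/

theorem norm_exp_le_of_norm_le {z : ℂ} {r : ℝ} (h : ‖z‖ ≤ r) : ‖Complex.exp z‖ ≤ Real.exp r := by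
  rw [Complex.norm_exp]
  exact Real.exp_le_exp.mpr (((le_abs_self _).trans (Complex.abs_re_le_norm z)).trans h)

theorem exists_norm_sigma_le : ∃ M : ℝ, 0 ≤ M ∧ ∀ (τ : ℍ) (z : ℂ), ‖z‖ = 1 →
    ‖sigma τ z‖ ≤ 2 * Real.exp Real.pi * Real.exp (M / (1 - ‖nome τ‖)) := by
  set K : ℝ := ∑' k : ℕ, 1 / ((k + 1 : ℝ) ^ 2) with hK
  have hK0 : 0 ≤ K := tsum_nonneg fun k => by positivity
  set E : ℝ := Real.exp (2 * Real.pi) with hE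
  -- Each product in the numerator contributes E, and the squared denominator contributes 2K.
  refine ⟨E + E + 2 * K, by positivity, fun τ z hz => ?_⟩
  have hq := norm_nome_lt_one τ
  have hq1 : 0 < 1 - ‖nome τ‖ := by linarith
  have hpi : ‖(Real.pi : ℂ) * Complex.I * z‖ ≤ Real.pi := by
    simp [hz, abs_of_pos Real.pi_pos]
  have h2pi : ‖2 * (Real.pi : ℂ) * Complex.I * z‖ ≤ 2 * Real.pi := by
    simp [hz, abs_of_pos Real.pi_pos]
  have hA : ∀ u : ℂ, ‖u‖ ≤ 2 * Real.pi →
      ‖qPoch (nome τ) (nome τ * Complex.exp u)‖ ≤ Real.exp (E / (1 - ‖nome τ‖)) := fun u hu => by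
    refine (norm_qPoch_le hq _).trans (Real.exp_le_exp.mpr ?_)
    gcongr
    rw [norm_mul]
    exact (mul_le_of_le_one_left (norm_nonneg _) hq.le).trans (norm_exp_le_of_norm_le hu)
  have hB : (‖qPoch (nome τ) (nome τ)‖ ^ 2)⁻¹ ≤ Real.exp (2 * K / (1 - ‖nome τ‖)) := by
    have h1 := exp_neg_le_norm_qPoch_self hq
    rw [← hK] at h1
    have h2 := pow_le_pow_left₀ (Real.exp_nonneg _) h1 2
    rw [← Real.exp_nat_mul] at h2
    have h3 := inv_anti₀ (Real.exp_pos _) h2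
    rw [← Real.exp_neg] at h3
    refine h3.trans (le_of_eq ?_)
    congr 1
    push_cast
    ring
  rw [sigma_eq, norm_mul, norm_div, norm_mul, norm_pow, add_div, add_div, Real.exp_add,
    Real.exp_add, div_eq_mul_inv]
  have hC : ‖Complex.exp (Real.pi * Complex.I * z) - Complex.exp (-(Real.pi * Complex.I * z))‖ ≤
      2 * Real.exp Real.pi := by
    refine (norm_sub_le _ _).trans ?_
    have h1 := norm_exp_le_of_norm_le hpi
    have h2 := norm_exp_le_of_norm_le (z := -(Real.pi * Complex.I * z)) (r := Real.pi)
      (by rwa [norm_neg])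
    linarith
  have h1 := hA _ h2pi
  have h2 := hA (-(2 * Real.pi * Complex.I * z)) (by rwa [norm_neg])
  gcongr

theorem norm_coeff_sigmaSeries_le {τ : ℍ} {C : ℝ} (hC : ∀ z : ℂ, ‖z‖ = 1 → ‖sigma τ z‖ ≤ C)
    (n : ℕ) : ‖PowerSeries.coeff n (sigmaSeries τ)‖ ≤ C := by
  have h := Complex.norm_iteratedDeriv_le_of_forall_mem_sphere_norm_le (c := 0) (R := 1) (n + 1)
    one_pos (differentiable_sigma τ).diffContOnCl fun z hz => hC z (by simpa using hz)
  have hf : (0 : ℝ) < ((n + 1).factorial : ℝ) := by positivity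
  rw [sigmaSeries, PowerSeries.coeff_mk, norm_div, Complex.norm_natCast, div_le_iff₀ hf]
  simpa [mul_comm] using h

theorem inv_one_sub_norm_nome_le (τ : ℍ) :
    (1 - ‖nome τ‖)⁻¹ ≤ 1 + (2 * Real.pi * τ.im)⁻¹ := by
  have hu : 0 < 2 * Real.pi * τ.im := by have := τ.im_pos; positivity
  have h1 : ‖nome τ‖ = (Real.exp (2 * Real.pi * τ.im))⁻¹ := by
    rw [nome, Complex.norm_exp, ← Real.exp_neg]
    congr 1
    simp
  have h2 := Real.add_one_le_exp (2 * Real.pi * τ.im)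
  have h3 : ‖nome τ‖ ≤ (2 * Real.pi * τ.im + 1)⁻¹ := by
    rw [h1]
    exact inv_anti₀ (by linarith) h2
  have h4 : (2 * Real.pi * τ.im) / (2 * Real.pi * τ.im + 1) ≤ 1 - ‖nome τ‖ := by
    have : (2 * Real.pi * τ.im) / (2 * Real.pi * τ.im + 1) =
      1 - (2 * Real.pi * τ.im + 1)⁻¹ := by field_simp; ring
    linarith
  refine (inv_anti₀ (by positivity) h4).trans (le_of_eq ?_)
  field_simp

/-- At hyperbolic distance t the imaginary part has shrunk by at most e^t, so 1 / (1 - |q|) is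
O(e^t). Cauchy's estimate on the unit circle transfers the bound for σ to its coefficients. -/
theorem exists_norm_coeff_sigmaSeries_le {c : ℝ → ℍ} (hc : IsGeodesicRay c) (n : ℕ) :
    ∃ C : ℝ, ∀ t : ℝ, 0 ≤ t →
      ‖PowerSeries.coeff n (sigmaSeries (c t))‖ ≤ Real.exp (C * Real.exp t) := by
  obtain ⟨M, hM0, hM⟩ := exists_norm_sigma_le
  set y : ℝ := (2 * Real.pi * (c 0).im)⁻¹ with hy
  have hy0 : 0 ≤ y := by have := (c 0).im_pos; positivity
  refine ⟨Real.log 2 + Real.pi + M * (1 + y), fun t ht => ?_⟩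
  refine (norm_coeff_sigmaSeries_le (hM (c t)) n).trans ?_
  have e1 : 1 ≤ Real.exp t := Real.one_le_exp ht
  have hdist : dist (c 0) (c t) = t := by
    rw [hc 0 t le_rfl ht, zero_sub, abs_neg, abs_of_nonneg ht]
  have him := UpperHalfPlane.im_div_exp_dist_le (c 0) (c t)
  rw [hdist] at him
  have h1 : (2 * Real.pi * (c t).im)⁻¹ ≤ y * Real.exp t := by
    have hp := (c 0).im_pos
    calc _ ≤ (2 * Real.pi * ((c 0).im / Real.exp t))⁻¹ := by gcongr
      _ = _ := by rw [hy]; field_simp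
  have h2 : M / (1 - ‖nome (c t)‖) ≤ M * (1 + y) * Real.exp t := by
    rw [div_eq_mul_inv, mul_assoc]
    refine mul_le_mul_of_nonneg_left ?_ hM0
    refine (inv_one_sub_norm_nome_le (c t)).trans ?_
    linarith
  have hlog : 0 ≤ Real.log 2 + Real.pi := by
    have := Real.log_nonneg one_le_two
    have := Real.pi_pos
    linarith
  calc _ = Real.exp (Real.log 2 + Real.pi + M / (1 - ‖nome (c t)‖)) := by
        rw [Real.exp_add, Real.exp_add, Real.exp_log two_pos]
    _ ≤ _ := by
        refine Real.exp_le_exp.mpr ?_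
        have := mul_le_mul_of_nonneg_left e1 hlog
        linarith

/-- The coefficients of `σ(τ, w) / w` as elements of `O(U)`. -/
def sigmaCoeff (U : Set ℍ) (n : ℕ) : holRing U :=
  ⟨fun τ => PowerSeries.coeff n (sigmaSeries τ.1),
    fun τ₀ => ⟨fun τ => PowerSeries.coeff n (sigmaSeries τ), analyticAt_coeff_sigmaSeries τ₀.1 n,
      Eventually.of_forall fun _ _ => rfl⟩,
    fun _ hc _ => exists_norm_coeff_sigmaSeries_le hc n⟩

/-- The ring homomorphism `O(U) → ℂ` given by evaluation at `τ`. -/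
def evalAt {U : Set ℍ} (τ : U) : holRing U →+* ℂ :=
  (Pi.evalRingHom (fun _ : U => ℂ) τ).comp (holRing U).val.toRingHom

theorem map_sigmaCoeff {U : Set ℍ} (τ : U) :
    (PowerSeries.mk (sigmaCoeff U)).map (evalAt τ) = sigmaSeries τ.1 := by
  ext n
  rw [PowerSeries.coeff_map, PowerSeries.coeff_mk]
  rfl

/-- With the inverse series passed as an argument, the cube is formed by substitutions and products
alone and so commutes with evaluation at τ. -/
theorem map_cubeOfInv {R S : Type*} [CommRing R] [CommRing S] (f : R →+* S)
    (p u : PowerSeries R) :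
    (cubeOfInv p u).map f = cubeOfInv (p.map f) (u.map f) := by
  simp only [cubeOfInv, map_mul, PowerSeries.map_subst (hasSubst_sumX _), map_sumX]

theorem exists_isCubicalClass (U : Set ℍ) : ∃ a : EllBorel U, IsCubicalClass a := by
  have h2 : (2 * Real.pi * Complex.I : ℂ) ≠ 0 := by
    simp [Real.pi_ne_zero, Complex.I_ne_zero]
  -- The constant coefficient of σ(w) / w is the constant function 2πi, a unit, so the inverse
  -- series exists over O(U) by pure algebra, with no growth estimate for 1 / σ.
  let v : (holRing U)ˣ := Units.map (algebraMap ℂ (holRing U)).toMonoidHom (Units.mk0 _ h2)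
  have hv : PowerSeries.constantCoeff (PowerSeries.mk (sigmaCoeff U)) = v := by
    rw [← PowerSeries.coeff_zero_eq_constantCoeff_apply, PowerSeries.coeff_mk]
    ext τ
    change PowerSeries.coeff 0 (sigmaSeries τ.1) = 2 * Real.pi * Complex.I
    simp [sigmaSeries, deriv_sigma_zero]
  refine ⟨cubeOfInv (PowerSeries.mk (sigmaCoeff U))
    (PowerSeries.invOfUnit (PowerSeries.mk (sigmaCoeff U)) v), fun τ => ?_⟩
  change MvPowerSeries.map (evalAt τ) _ = _
  have h := congrArg (PowerSeries.map (evalAt τ)) (PowerSeries.mul_invOfUnit _ v hv)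
  rw [map_mul, map_one, map_sigmaCoeff] at h
  rw [map_cubeOfInv, map_sigmaCoeff, cubicalSeries_eq h]

theorem sigmaClass_isRefinement (U : Set ℍ) : (sigmaClass U).IsRefinement := by
  obtain ⟨a, ha⟩ := exists_isCubicalClass U
  exact ⟨a, ha, sigmaClass_hasCompletion ha⟩

theorem TwistedClass.IsRefinement.eq_sigmaClass {U : Set ℍ} {s : TwistedClass U}
    (hs : s.IsRefinement) : s = sigmaClass U := by
  obtain ⟨a, ha, hsa⟩ := hs
  exact eq_of_hasCompletion hsa (sigmaClass_hasCompletion ha) fun _ => rfl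

end EllCube

end

theorem mainTheorem4 :
    (∀ U : Set UpperHalfPlane, EllCube.IsHolSubmanifold U →
      (∃! s : EllCube.TwistedClass U, s.IsRefinement) ∧
      (∀ s : EllCube.TwistedClass U, s.IsRefinement →
        ∀ (τ : U) (x : Fin 3 → ℂ),
          s.toFun τ (EllCube.proj τ.1 x) = EllCube.eulerClass EllCube.V₃ τ.1 x)) ∧
    (∀ s : EllCube.TwistedClass Set.univ, s.IsRefinement → s.Descends) := by
  refine ⟨fun U _ => ⟨⟨EllCube.sigmaClass U, EllCube.sigmaClass_isRefinement U,
    fun s hs => hs.eq_sigmaClass⟩, fun s hs τ x => ?_⟩, fun s hs => ?_⟩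
  · rw [hs.eq_sigmaClass, EllCube.sigmaClass_apply, EllCube.eulerClass_V₃]
  · rw [hs.eq_sigmaClass]
    exact EllCube.sigmaClass_descends
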